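/- Let $n\ge 1$, $P_{mis}\in\mathbb R$, $R>0$. For $i=1,\dots,n$ let $\bar f_i:\mathbb R\to\mathbb R$ be differentiable and strongly convex with locally Lipschitz derivative (for instance $\bar f_i(x)=\gamma_i x^2+\beta_i x+\alpha_i$ with $\gamma_i>0$), let $\underline m_i,\overline m_i\in\mathbb R$, and put, for $c\ge 0$ and an integer $\sigma\ge 2$, $$f_i(x)=\bar f_i(x)+c\big(\max\{x-\overline m_i,0\}^\sigma+\max\{-\underline m_i-x,0\}^\sigma\big).$$ Let $W\in\mathbb R^{n\times n}$ be symmetric with nonnegative entries, $W_{max}=\max_i\sum_j W_{ij}$, $\mathrm{sat}(u)=\max\{-1,\min\{1,u\}\}$, and let $\overline\tau\ge 0$ be an integer. The problem of minimizing $\sum_i f_i(x_i)$ subject to $\sum_i x_i=P_{mis}$ has a unique solution $\mathbf x^*$; if $-\underline m_i\le x_i^*\le\overline m_i$ for all $i$, then $\mathbf x^*$ also minimizes $\sum_i\bar f_i(x_i)$ subject to $\sum_i x_i=P_{mis}$ and $-\underline m_i\le x_i\le\overline m_i$. Moreover, for every $\rho$ there is $\eta_0>0$ (depending only on the data above and on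 $\rho$) such that the following holds for every step $0<\eta_\tau\le\eta_0$. Let $\mathcal G(k)$, $k=0,1,2,\dots$, be undirected graphs on $\{1,\dots,n\}$ with $W_{ij}>0$ for each link $(i,j)$ of each $\mathcal G(k)$, and let $B\ge0$ be an integer such that $\bigcup_{k=t}^{t+B}\mathcal G(k)$ is connected for every $t\ge0$. Let $\tau_{ij}(k)\in\{0,\dots,\overline\tau\}$ be arbitrary (time-varying and heterogeneous) delays, $\mathcal I_{k,ij}(r)=1$ if $\tau_{ij}(k)=r$ and $0$ otherwise, and $\mathcal N_i(k)$ the set of neighbours of $i$ in $\mathcal G(k)$. Data travels over the links present when it is sent, and none is sent before step $0$. Let $\sum_i x_i(0)=P_{mis}$ and $|x_i(0)|\le\rho$ for all $i$. (1) If, for all $k\ge0$ and $i$, $$x_i(k+1)=x_i(k)-\frac{\eta_\tau R}{W_{max}}\sum_{r=0}^{\min\{\overline\tau,k\}}\ \sum_{j\in\mathcal N_i(k-r)}W_{ij}\,\mathrm{sat}\big(f_i'(x_i(k-r))-f_j'(x_j(k-r))\big)\,\mathcal I_{k-r,ij}(r),$$ then $\mathbf x(k)\to\mathbf x^*$ as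 $k\to\infty$. (2) If $\mathbf x:[0,\infty)\to\mathbb R^n$ is continuous and, for all integers $k\ge 0$, all $k<t<k+1$ and all $i$, $$\dot x_i(t)=-\frac{\eta_\tau R}{W_{max}}\sum_{r=0}^{\min\{\overline\tau,k\}}\ \sum_{j\in\mathcal N_i(k-r)}W_{ij}\,\mathrm{sat}\big(f_i'(x_i(s-r))-f_j'(x_j(s-r))\big)\,\mathcal I_{k-r,ij}(r),$$ where either $s=k$ throughout (states exchanged at the sampling times) or $s=t$ throughout (states exchanged continuously), then $\mathbf x(t)\to\mathbf x^*$ as $t\to\infty$. (For $n=1$ the sums are empty and the right-hand sides are $0$.) -/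

import Mathlib

open Filter Topology

namespace AGC

/-- Generation costs: strongly convex, differentiable, with locally Lipschitz derivative. -/
def RegularCost (f : ℝ → ℝ) : Prop :=
  (∃ v : ℝ, 0 < v ∧ StrongConvexOn Set.univ v f) ∧ Differentiable ℝ f ∧
    LocallyLipschitz (deriv f)

/-- The quadratic generation costs `γ x² + β x + α` with `γ > 0` are regular. -/
theorem regularCost_quadratic (γ β α : ℝ) (hγ : 0 < γ) :
    RegularCost (fun x => γ * x ^ 2 + β * x + α) := by
  have hd : deriv (fun x : ℝ => γ * x ^ 2 + β * x + α) = fun x => 2 * γ * x + β := by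
    funext x
    have h1 : HasDerivAt (fun x : ℝ => γ * x ^ 2 + β * x + α) (2 * γ * x + β) x := by
      have h2 := (((hasDerivAt_id x).pow 2).const_mul γ).add ((hasDerivAt_id x).const_mul β)
      have h3 := h2.add_const α
      have h4 : γ * (((2 : ℕ) : ℝ) * id x ^ (2 - 1) * 1) + β * 1 = 2 * γ * x + β := by
        simp only [id, Nat.cast_ofNat]
        ring
      exact h4 ▸ h3
    exact h1.deriv
  refine ⟨⟨2 * γ, by positivity, ?_⟩, by fun_prop, ?_⟩
  · rw [strongConvexOn_iff_convex]
    refine ⟨convex_univ, fun x _ y _ a b _ _ hab => ?_⟩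
    have hb : b = 1 - a := by linarith
    subst hb
    simp only [smul_eq_mul, Real.norm_eq_abs, sq_abs]
    apply le_of_eq
    ring
  · rw [hd]
    exact (ContDiff.locallyLipschitz (by fun_prop : ContDiff ℝ 1 fun x : ℝ => 2 * γ * x + β))

/-- The penalty `[u]⁺ = max {u, 0} ^ σ`. -/
noncomputable def penalty (σ : ℕ) (u : ℝ) : ℝ := max u 0 ^ σ

/-- The local objective `f_i`: generation cost plus weighted penalties for the box constraint
`-mlo ≤ x ≤ mhi`. -/
noncomputable def objective (fbar : ℝ → ℝ) (mlo mhi c : ℝ) (σ : ℕ) (x : ℝ) : ℝ :=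
  fbar x + c * (penalty σ (x - mhi) + penalty σ (-mlo - x))

/-- `z` minimizes `∑ i, f i (z i)` over the allocations in `S` with total power `P`. -/
def IsOptimalOn {n : ℕ} (f : Fin n → ℝ → ℝ) (P : ℝ) (S : Set (Fin n → ℝ)) (z : Fin n → ℝ) :
    Prop :=
  z ∈ S ∧ ∑ i, z i = P ∧ ∀ y ∈ S, ∑ i, y i = P → ∑ i, f i (z i) ≤ ∑ i, f i (y i)

/-- The box `-mlo i ≤ x i ≤ mhi i`. -/
def box {n : ℕ} (mlo mhi : Fin n → ℝ) : Set (Fin n → ℝ) :=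
  {x | ∀ i, -mlo i ≤ x i ∧ x i ≤ mhi i}

/-- The unit saturation function. -/
noncomputable def sat (u : ℝ) : ℝ := max (-1) (min 1 u)

/-- `W_max`, the largest row sum of the weight matrix. -/
noncomputable def maxRowSum {n : ℕ} (W : Matrix (Fin n) (Fin n) ℝ) : ℝ := ⨆ i, ∑ j, W i j

/-- The union of the graphs over every time window `[t, t + B]` is connected. -/
def UniformlyConnected {n : ℕ} (G : ℕ → SimpleGraph (Fin n)) (B : ℕ) : Prop :=
  ∀ t : ℕ, (⨆ k ∈ Set.Icc t (t + B), G k).Connected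

/-- `1` if data exchanged over the link `(i, j)` at step `k` has delay `r`, else `0`. -/
def delayIndicator {n : ℕ} (τ : ℕ → Fin n → Fin n → ℕ) (k : ℕ) (i j : Fin n) (r : ℕ) : ℝ :=
  if τ k i j = r then 1 else 0

open Classical in
/-- The delayed saturated update of node `i` at step `k`, where `z m` is the state whose gradients
are exchanged at step `m`. Data sent at step `k - r` travels over the links `G (k - r)` present
when it is sent; no data is sent before step `0`, so only the summands with `r ≤ k` occur. -/
noncomputable def delayedRate {n : ℕ} (f : Fin n → ℝ → ℝ) (W : Matrix (Fin n) (Fin n) ℝ)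
    (R η : ℝ) (τbar : ℕ) (G : ℕ → SimpleGraph (Fin n)) (τ : ℕ → Fin n → Fin n → ℕ)
    (z : ℕ → Fin n → ℝ) (k : ℕ) (i : Fin n) : ℝ :=
  -(η * (R / maxRowSum W)) * ∑ j, ∑ r ∈ Finset.range (τbar + 1),
    if r ≤ k ∧ (G (k - r)).Adj i j then
      W i j * sat (deriv (f i) (z (k - r) i) - deriv (f j) (z (k - r) j)) *
        delayIndicator τ (k - r) i j r
    else 0

/-- Discrete-time trajectories of the delayed dynamics. -/
def IsDiscreteTrajectory {n : ℕ} (f : Fin n → ℝ → ℝ) (W : Matrix (Fin n) (Fin n) ℝ)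
    (R η : ℝ) (τbar : ℕ) (G : ℕ → SimpleGraph (Fin n)) (τ : ℕ → Fin n → Fin n → ℕ)
    (x : ℕ → Fin n → ℝ) : Prop :=
  ∀ k i, x (k + 1) i = x k i + delayedRate f W R η τbar G τ x k i

/-- Continuous-time trajectories with exchanged states sampled at the integer times: for
`k < t < k + 1`, the derivative at time `t` is the delayed update built from the states
`x (k - r)`. -/
def IsSampledTrajectory {n : ℕ} (f : Fin n → ℝ → ℝ) (W : Matrix (Fin n) (Fin n) ℝ)
    (R η : ℝ) (τbar : ℕ) (G : ℕ → SimpleGraph (Fin n)) (τ : ℕ → Fin n → Fin n → ℕ)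
    (x : ℝ → Fin n → ℝ) : Prop :=
  ContinuousOn x (Set.Ici 0) ∧ ∀ (k : ℕ) (θ : ℝ), θ ∈ Set.Ioo (0 : ℝ) 1 → ∀ i,
    HasDerivAt (fun t => x t i)
      (delayedRate f W R η τbar G τ (fun m => x (m : ℝ)) k i) ((k : ℝ) + θ)

/-- Continuous-time trajectories with continuously exchanged states: for `k < t < k + 1`, the
derivative at time `t = k + θ` is the delayed update built from the states
`x (t - r) = x ((k - r) + θ)`; links and delays are constant between integer times. -/
def IsContinuousTrajectory {n : ℕ} (f : Fin n → ℝ → ℝ) (W : Matrix (Fin n) (Fin n) ℝ)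
    (R η : ℝ) (τbar : ℕ) (G : ℕ → SimpleGraph (Fin n)) (τ : ℕ → Fin n → Fin n → ℕ)
    (x : ℝ → Fin n → ℝ) : Prop :=
  ContinuousOn x (Set.Ici 0) ∧ ∀ (k : ℕ) (θ : ℝ), θ ∈ Set.Ioo (0 : ℝ) 1 → ∀ i,
    HasDerivAt (fun t => x t i)
      (delayedRate f W R η τbar G τ (fun m => x ((m : ℝ) + θ)) k i) ((k : ℝ) + θ)

end AGC

namespace AGC

/-! The optimum is the allocation with equal marginal costs: strong convexity makes each derivative
an increasing bijection of the line, and the total cost grows quadratically away from that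
allocation.

The obstacle to convergence is that delays may differ in the two directions of a link, so the actual
state need not keep its total power. The analysis therefore follows `undelayedState`, in which every
transfer takes effect when it is sent. Its total is conserved because transfers are antisymmetric,
and it differs from the actual state only by the transfers still in flight, hence by at most the
absolute flow `totalFlow` of the last `T + 1` steps
(`IsAveragedTrajectory.abs_sub_undelayedState_le`).

The total cost at the undelayed state is a Lyapunov function. One step lowers it by a multiple of
the squared flow, up to an error quadratic in the recent flow (`sum_cost_step_le`). The gain is of
order `1 / η` and the error coefficient does not depend on `η`, so for small `η` summation absorbs
the errors (`le_sub_of_delayed_dissipation`) and the squared flows are summable. Vanishing flow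
forces marginal costs to agree asymptotically across active links. As they also vary slowly, uniform
connectivity spreads the agreement to all nodes (`tendsto_sub_of_uniformlyConnected`), and strong
convexity turns it into convergence (`tendsto_of_marginal_consensus`).

The three dynamics are treated at once through `IsAveragedTrajectory`. -/

/-! ### The saturation function -/

theorem sat_neg (u : ℝ) : sat (-u) = -sat u := by
  unfold sat
  rcases le_total 1 u with h | h <;> rcases le_total (-1) u with h' | h' <;>
    simp only [min_def, max_def] <;> split_ifs <;> linarith

theorem abs_sat_le_one (u : ℝ) : |sat u| ≤ 1 :=
  abs_le.2 ⟨le_max_left _ _, max_le (by norm_num) (min_le_left _ _)⟩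

/-- `sat u` lies between `0` and `u`. This is the source of all dissipation. -/
theorem sat_sq_le (u : ℝ) : sat u ^ 2 ≤ sat u * u := by
  unfold sat
  simp only [min_def, max_def]
  split_ifs <;> nlinarith

theorem continuous_sat : Continuous sat := by
  unfold sat
  fun_prop

theorem abs_sat_sub_sat_le (u v : ℝ) : |sat u - sat v| ≤ |u - v| := by
  unfold sat
  have h1 := abs_max_sub_max_le_max (-1) (min 1 u) (-1) (min 1 v)
  have h2 := abs_min_sub_min_le_max 1 u 1 v
  simp only [sub_self, abs_zero, abs_nonneg, max_eq_right] at h1 h2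
  exact h1.trans h2

theorem sat_eq_self_of_abs_lt {u : ℝ} (h : |sat u| < 1) : sat u = u := by
  unfold sat at *
  obtain ⟨h1, h2⟩ := abs_lt.1 h
  simp only [min_def, max_def] at *
  split_ifs at * <;> linarith

/-! ### Regularity of the penalized costs -/

/-- Away from `0` the penalty is locally zero or a power. Continuity of the penalty and of the
candidate derivative settles the kink. -/
theorem hasDerivAt_penalty {σ : ℕ} (hσ : 2 ≤ σ) (u : ℝ) :
    HasDerivAt (penalty σ) (σ * max u 0 ^ (σ - 1)) u := by
  refine hasDerivAt_of_hasDerivAt_of_ne' (x := 0) (g := fun u => σ * max u 0 ^ (σ - 1))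
    (fun y hy => ?_) ?_ ?_ u
  · rcases lt_or_gt_of_ne hy with h | h
    · have h0 : penalty σ =ᶠ[𝓝 y] fun _ => (0 : ℝ) := by
        filter_upwards [gt_mem_nhds h] with z hz
        simp [penalty, max_eq_right hz.le, show σ ≠ 0 by omega]
      rw [max_eq_right h.le, zero_pow (by omega), mul_zero]
      exact (hasDerivAt_const y (0 : ℝ)).congr_of_eventuallyEq h0
    · have h0 : penalty σ =ᶠ[𝓝 y] fun z => z ^ σ := by
        filter_upwards [lt_mem_nhds h] with z hz
        simp [penalty, max_eq_left hz.le]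
      rw [max_eq_left h.le]
      exact (hasDerivAt_pow σ y).congr_of_eventuallyEq h0
  · unfold penalty
    fun_prop
  · fun_prop

theorem convexOn_penalty (σ : ℕ) (a b : ℝ) :
    ConvexOn ℝ Set.univ fun x => penalty σ (a * x + b) := by
  have h : ConvexOn ℝ Set.univ fun x : ℝ => a * x + b :=
    ⟨convex_univ, fun x _ y _ s t _ _ hst => le_of_eq (by
      simp only [smul_eq_mul]
      linear_combination (-b) * hst)⟩
  exact (h.sup (convexOn_const 0 convex_univ)).pow (fun x _ => le_max_right _ _) σ

theorem regularCost_objective {fbar : ℝ → ℝ} (hfbar : RegularCost fbar) (mlo mhi : ℝ) {c : ℝ}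
    (hc : 0 ≤ c) {σ : ℕ} (hσ : 2 ≤ σ) : RegularCost (objective fbar mlo mhi c σ) := by
  obtain ⟨⟨v, hv, hconv⟩, hdiff, hlip⟩ := hfbar
  have hpen : ∀ x, HasDerivAt
      (fun x => c * (penalty σ (x - mhi) + penalty σ (-mlo - x)))
      (c * (σ * max (x - mhi) 0 ^ (σ - 1) + σ * max (-mlo - x) 0 ^ (σ - 1) * (-1))) x := by
    intro x
    refine HasDerivAt.const_mul c (HasDerivAt.add ?_ ?_)
    · simpa [Function.comp_def] using
        (hasDerivAt_penalty hσ (x - mhi)).comp x ((hasDerivAt_id x).sub_const mhi)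
    · exact (hasDerivAt_penalty hσ (-mlo - x)).comp x ((hasDerivAt_id x).const_sub (-mlo))
  have hder : ∀ x, HasDerivAt (objective fbar mlo mhi c σ) _ x := fun x =>
    (hdiff x).hasDerivAt.add (hpen x)
  refine ⟨⟨v, hv, ?_⟩, fun x => (hder x).differentiableAt, ?_⟩
  · have h1 := (convexOn_penalty σ 1 (-mhi)).add (convexOn_penalty σ (-1) (-mlo))
    have h2 := strongConvexOn_zero.2 (h1.smul hc)
    have h3 := UniformConvexOn.add hconv h2
    have h4 : objective fbar mlo mhi c σ = fbar + fun x => c •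
        ((fun x => penalty σ (1 * x + -mhi)) + fun x => penalty σ (-1 * x + -mlo)) x := by
      funext x
      simp only [objective, Pi.add_apply, smul_eq_mul]
      ring_nf
    rw [h4]
    unfold StrongConvexOn
    convert h3 using 1
    funext r
    simp
  · have h1 : deriv (objective fbar mlo mhi c σ) = fun x => deriv fbar x +
        c * (σ * max (x - mhi) 0 ^ (σ - 1) + σ * max (-mlo - x) 0 ^ (σ - 1) * (-1)) :=
      funext fun x => (hder x).deriv
    rw [h1]
    have h2 : LocallyLipschitz fun p : ℝ × ℝ =>
        c * (σ * p.1 ^ (σ - 1) + σ * p.2 ^ (σ - 1) * (-1)) :=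
      ContDiff.locallyLipschitz (𝕂 := ℝ) (by fun_prop)
    have h3 : LocallyLipschitz fun x : ℝ => max (x - mhi) 0 :=
      (ContDiff.locallyLipschitz (𝕂 := ℝ) (by fun_prop)).max_const 0
    have h4 : LocallyLipschitz fun x : ℝ => max (-mlo - x) 0 :=
      (ContDiff.locallyLipschitz (𝕂 := ℝ) (by fun_prop)).max_const 0
    have h5 := h2.comp (h3.prodMk h4)
    have h6 : LocallyLipschitz fun p : ℝ × ℝ => p.1 + p.2 :=
      ContDiff.locallyLipschitz (𝕂 := ℝ) (by fun_prop)
    exact h6.comp (hlip.prodMk h5)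

/-! ### Convexity estimates for a single cost -/

/-- Quadratic growth of a regular cost above its tangents. -/
theorem RegularCost.exists_tangent_le {f : ℝ → ℝ} (hf : RegularCost f) :
    ∃ v : ℝ, 0 < v ∧ ∀ x y, f x + deriv f x * (y - x) + v / 2 * (y - x) ^ 2 ≤ f y := by
  obtain ⟨⟨v, hv, hconv⟩, hdiff, -⟩ := hf
  refine ⟨v, hv, fun x y => ?_⟩
  rw [strongConvexOn_iff_convex] at hconv
  simp only [Real.norm_eq_abs, sq_abs] at hconv
  have hd : HasDerivAt (fun z => f z - v / 2 * z ^ 2) (deriv f x - v * x) x := by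
    have h := (hdiff x).hasDerivAt.sub ((hasDerivAt_pow 2 x).const_mul (v / 2))
    rwa [show deriv f x - v * x = deriv f x - v / 2 * ((2 : ℕ) * x ^ (2 - 1)) by
      push_cast; ring]
  rcases lt_trichotomy x y with h | h | h
  · have h1 := hconv.le_slope_of_hasDerivAt (Set.mem_univ x) (Set.mem_univ y) h hd
    rw [slope_def_field, le_div_iff₀ (by linarith)] at h1
    nlinarith
  · subst h
    simp
  · have h1 := hconv.slope_le_of_hasDerivAt (Set.mem_univ y) (Set.mem_univ x) h hd
    rw [slope_def_field, div_le_iff₀ (by linarith)] at h1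
    nlinarith

theorem RegularCost.exists_lipschitz_deriv {f : ℝ → ℝ} (hf : RegularCost f) (M : ℝ) :
    ∃ L : ℝ, 0 ≤ L ∧ ∀ x y, |x| ≤ M → |y| ≤ M → |deriv f x - deriv f y| ≤ L * |x - y| := by
  obtain ⟨K, hK⟩ := (hf.2.2.locallyLipschitzOn
    (s := Set.Icc (-M) M)).exists_lipschitzOnWith_of_compact isCompact_Icc
  refine ⟨K, K.2, fun x y hx hy => ?_⟩
  simpa [Real.dist_eq] using hK.dist_le_mul x (abs_le.1 hx) y (abs_le.1 hy)

/-- The tangent inequality at `y` bounds `f y` with slope `deriv f y`; exchanging that slope for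
`deriv f x` costs `L * (y - x) ^ 2`. -/
theorem RegularCost.le_of_lipschitz_deriv {f : ℝ → ℝ} (hf : RegularCost f) {M L : ℝ}
    (hlip : ∀ x y, |x| ≤ M → |y| ≤ M → |deriv f x - deriv f y| ≤ L * |x - y|) {x y : ℝ}
    (hx : |x| ≤ M) (hy : |y| ≤ M) : f y ≤ f x + deriv f x * (y - x) + L * (y - x) ^ 2 := by
  obtain ⟨v, hv, hg⟩ := hf.exists_tangent_le
  have h1 := hg y x
  have h2 : (deriv f y - deriv f x) * (y - x) ≤ L * (y - x) ^ 2 := by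
    calc _ ≤ |(deriv f y - deriv f x) * (y - x)| := le_abs_self _
      _ = |deriv f y - deriv f x| * |y - x| := abs_mul _ _
      _ ≤ L * |y - x| * |y - x| := by gcongr; exact hlip y x hy hx
      _ = L * (y - x) ^ 2 := by rw [mul_assoc, ← sq, sq_abs]
  nlinarith [mul_nonneg hv.le (sq_nonneg (x - y))]

/-- Adding the tangent inequalities at `x` and `y` shows that the derivative grows at rate at least
`v`, so it is strictly increasing and unbounded in both directions. -/
theorem RegularCost.deriv_orderIso {f : ℝ → ℝ} (hf : RegularCost f) :
    ∃ e : ℝ ≃o ℝ, ∀ x, e x = deriv f x := by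
  obtain ⟨v, hv, hg⟩ := hf.exists_tangent_le
  have hmono : ∀ x y, v * (y - x) ^ 2 ≤ (deriv f y - deriv f x) * (y - x) := fun x y => by
    nlinarith [hg x y, hg y x]
  have hgrow : ∀ x y, x ≤ y → v * (y - x) ≤ deriv f y - deriv f x := fun x y hxy => by
    rcases hxy.eq_or_lt with rfl | h
    · simp
    · have := hmono x y
      have h' : 0 < y - x := by linarith
      by_contra! hcon
      nlinarith
  have hs : StrictMono (deriv f) := fun x y hxy => by
    nlinarith [hgrow x y hxy.le, mul_pos hv (sub_pos.2 hxy)]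
  have hsurj : Function.Surjective (deriv f) := by
    refine hf.2.2.continuous.surjective ?_ ?_
    · refine tendsto_atTop_mono' atTop (f₁ := fun x => v * x + deriv f 0) ?_ ?_
      · filter_upwards [eventually_ge_atTop 0] with x hx
        linarith [hgrow 0 x hx]
      · exact tendsto_atTop_add_const_right _ _ (tendsto_id.const_mul_atTop hv)
    · refine tendsto_atBot_mono' atBot (f₁ := fun x => v * x + deriv f 0) ?_ ?_
      · filter_upwards [eventually_le_atBot 0] with x hx
        linarith [hgrow x 0 hx]
      · exact tendsto_atBot_add_const_right _ _ (tendsto_id.const_mul_atBot hv)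
  exact ⟨StrictMono.orderIsoOfSurjective _ hs hsurj, fun x => rfl⟩

/-! ### Existence, uniqueness and characterization of the optimum -/

/-- An allocation of the total power `P` with equal marginal costs exists. -/
theorem exists_equal_marginal_costs {n : ℕ} (hn : 0 < n) {f : Fin n → ℝ → ℝ}
    (hf : ∀ i, RegularCost (f i)) (P : ℝ) :
    ∃ (z : Fin n → ℝ) (l : ℝ), (∀ i, deriv (f i) (z i) = l) ∧ ∑ i, z i = P := by
  choose e he using fun i => (hf i).deriv_orderIso
  have hne : (Finset.univ : Finset (Fin n)).Nonempty := ⟨⟨0, hn⟩, Finset.mem_univ _⟩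
  -- The total power of the allocation with common marginal cost `l` is continuous in `l` and
  -- unbounded both ways, so it takes the value `P`.
  have hsurj : Function.Surjective fun l => ∑ i, (e i).symm l := by
    refine Continuous.surjective ?_ ?_ ?_
    · exact continuous_finsetSum _ fun i _ => (e i).symm.continuous
    · rw [tendsto_atTop]
      intro b
      have h : ∀ᶠ l in atTop, ∀ i, b / n ≤ (e i).symm l :=
        eventually_all.2 fun i => (tendsto_atTop.1 (e i).symm.tendsto_atTop) _
      filter_upwards [h] with l hl
      calc b = ∑ _i : Fin n, b / n := by simp; field_simp
        _ ≤ _ := Finset.sum_le_sum fun i _ => hl i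
    · rw [tendsto_atBot]
      intro b
      have h : ∀ᶠ l in atBot, ∀ i, (e i).symm l ≤ b / n :=
        eventually_all.2 fun i => (tendsto_atBot.1 (e i).symm.tendsto_atBot) _
      filter_upwards [h] with l hl
      calc _ ≤ ∑ _i : Fin n, b / n := Finset.sum_le_sum fun i _ => hl i
        _ = b := by simp; field_simp
  obtain ⟨l, hl⟩ := hsurj P
  exact ⟨fun i => (e i).symm l, l, fun i => by rw [← he, OrderIso.apply_symm_apply], hl⟩

theorem exists_tangent_le_uniform {n : ℕ} {f : Fin n → ℝ → ℝ} (hf : ∀ i, RegularCost (f i)) :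
    ∃ v : ℝ, 0 < v ∧
      ∀ i x y, f i x + deriv (f i) x * (y - x) + v / 2 * (y - x) ^ 2 ≤ f i y := by
  choose v hv h using fun i => (hf i).exists_tangent_le
  have h1 : ∀ᶠ u in 𝓝[>] (0 : ℝ), ∀ i, u ≤ v i := eventually_all.2 fun i =>
    mem_of_superset (Ioo_mem_nhdsGT (hv i)) fun u hu => hu.2.le
  obtain ⟨u, hu, hu0⟩ := (h1.and self_mem_nhdsWithin).exists
  refine ⟨u, hu0, fun i x y => le_trans ?_ (h i x y)⟩
  gcongr
  exact hu i

theorem exists_lipschitz_deriv_uniform {n : ℕ} {f : Fin n → ℝ → ℝ}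
    (hf : ∀ i, RegularCost (f i)) (M : ℝ) :
    ∃ L : ℝ, 0 ≤ L ∧
      ∀ i x y, |x| ≤ M → |y| ≤ M → |deriv (f i) x - deriv (f i) y| ≤ L * |x - y| := by
  choose L hL h using fun i => (hf i).exists_lipschitz_deriv M
  refine ⟨∑ i, L i, Finset.sum_nonneg fun i _ => hL i, fun i x y hx hy =>
    (h i x y hx hy).trans ?_⟩
  gcongr
  exact Finset.single_le_sum (fun j _ => hL j) (Finset.mem_univ i)

/-- The total cost grows quadratically away from the allocation with equal marginal costs. -/
theorem sum_add_sq_le_of_equal_marginal_costs {n : ℕ} {f : Fin n → ℝ → ℝ} {v : ℝ}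
    (hv : ∀ i x y, f i x + deriv (f i) x * (y - x) + v / 2 * (y - x) ^ 2 ≤ f i y)
    {z y : Fin n → ℝ} {l : ℝ} (hz : ∀ i, deriv (f i) (z i) = l) (hsum : ∑ i, y i = ∑ i, z i) :
    ∑ i, f i (z i) + v / 2 * ∑ i, (y i - z i) ^ 2 ≤ ∑ i, f i (y i) := by
  have h := Finset.sum_le_sum fun i (_ : i ∈ Finset.univ) => hv i (z i) (y i)
  simp only [hz, Finset.sum_add_distrib, ← Finset.mul_sum, Finset.sum_sub_distrib, hsum] at h
  linarith

theorem isOptimalOn_of_equal_marginal_costs {n : ℕ} {f : Fin n → ℝ → ℝ} {v : ℝ} (hv0 : 0 < v)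
    (hv : ∀ i x y, f i x + deriv (f i) x * (y - x) + v / 2 * (y - x) ^ 2 ≤ f i y)
    {z : Fin n → ℝ} {l : ℝ} (hz : ∀ i, deriv (f i) (z i) = l) {P : ℝ} (hP : ∑ i, z i = P) :
    IsOptimalOn f P Set.univ z ∧ ∀ y, IsOptimalOn f P Set.univ y → y = z := by
  refine ⟨⟨Set.mem_univ _, hP, fun y _ hy => ?_⟩, fun y hy => ?_⟩
  · have h := sum_add_sq_le_of_equal_marginal_costs hv hz (hy.trans hP.symm)
    have h1 : 0 ≤ ∑ i, (y i - z i) ^ 2 := Finset.sum_nonneg fun i _ => sq_nonneg _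
    nlinarith
  · have h := sum_add_sq_le_of_equal_marginal_costs hv hz (hy.2.1.trans hP.symm)
    have h1 := hy.2.2 z (Set.mem_univ _) hP
    have h2 : ∑ i, (y i - z i) ^ 2 ≤ 0 := by
      by_contra! hcon
      nlinarith
    funext i
    have h3 := Finset.single_le_sum (fun i _ => sq_nonneg (y i - z i)) (Finset.mem_univ i)
    have h4 : (y i - z i) ^ 2 = 0 := le_antisymm (h3.trans h2) (sq_nonneg _)
    exact sub_eq_zero.1 (pow_eq_zero_iff two_ne_zero |>.1 h4)

theorem objective_eq_of_mem {fbar : ℝ → ℝ} {mlo mhi c x : ℝ} {σ : ℕ} (hσ : 2 ≤ σ)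
    (hx : -mlo ≤ x ∧ x ≤ mhi) : objective fbar mlo mhi c σ x = fbar x := by
  have h1 : max (x - mhi) 0 = 0 := max_eq_right (by linarith)
  have h2 : max (-mlo - x) 0 = 0 := max_eq_right (by linarith)
  simp [objective, penalty, h1, h2, show σ ≠ 0 by omega]

theorem isOptimalOn_box {n : ℕ} {f fbar : Fin n → ℝ → ℝ} {mlo mhi : Fin n → ℝ} {c P : ℝ} {σ : ℕ}
    (hσ : 2 ≤ σ) (hf : ∀ i, f i = objective (fbar i) (mlo i) (mhi i) c σ) {z : Fin n → ℝ}
    (hz : IsOptimalOn f P Set.univ z) (hbox : z ∈ box mlo mhi) :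
    IsOptimalOn fbar P (box mlo mhi) z := by
  have h : ∀ y ∈ box mlo mhi, ∑ i, f i (y i) = ∑ i, fbar i (y i) := fun y hy =>
    Finset.sum_congr rfl fun i _ => by rw [hf, objective_eq_of_mem hσ (hy i)]
  refine ⟨hbox, hz.2.1, fun y hy hyP => ?_⟩
  rw [← h y hy, ← h z hbox]
  exact hz.2.2 y (Set.mem_univ _) hyP

/-! ### Sums over sliding windows -/

/-- The sum of `α` over the window of the last `T + 1` indices up to `k`, truncated at `0`. -/
noncomputable def recentSum (α : ℕ → ℝ) (T k : ℕ) : ℝ := ∑ m ∈ Finset.Icc (k - T) k, α m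

theorem le_recentSum {α : ℕ → ℝ} (hα : ∀ k, 0 ≤ α k) (T k : ℕ) : α k ≤ recentSum α T k :=
  Finset.single_le_sum (fun m _ => hα m) (by simp)

theorem recentSum_nonneg {α : ℕ → ℝ} (hα : ∀ k, 0 ≤ α k) (T k : ℕ) : 0 ≤ recentSum α T k :=
  Finset.sum_nonneg fun m _ => hα m

theorem recentSum_le {α : ℕ → ℝ} {b : ℝ} (hb : 0 ≤ b) (hα : ∀ k, α k ≤ b) (T k : ℕ) :
    recentSum α T k ≤ (T + 1) * b := by
  calc recentSum α T k ≤ (Finset.Icc (k - T) k).card • b :=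
        Finset.sum_le_card_nsmul _ _ _ fun m _ => hα m
    _ ≤ (T + 1) * b := by
        rw [nsmul_eq_mul, Nat.card_Icc]
        gcongr
        exact_mod_cast (by omega : k + 1 - (k - T) ≤ T + 1)

theorem recentSum_sq_le (α : ℕ → ℝ) (T k : ℕ) :
    recentSum α T k ^ 2 ≤ (T + 1) * recentSum (fun m => α m ^ 2) T k := by
  refine (sq_sum_le_card_mul_sum_sq).trans ?_
  rw [Nat.card_Icc]
  refine mul_le_mul_of_nonneg_right ?_ (recentSum_nonneg (fun m => sq_nonneg (α m)) T k)
  exact_mod_cast (by omega : k + 1 - (k - T) ≤ T + 1)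

/-- Each index belongs to at most `T + 1` windows. -/
theorem sum_recentSum_le {β : ℕ → ℝ} (hβ : ∀ k, 0 ≤ β k) (T K : ℕ) :
    ∑ k ∈ Finset.range K, recentSum β T k ≤ (T + 1) * ∑ k ∈ Finset.range K, β k := by
  unfold recentSum
  rw [Finset.sum_comm' (t' := Finset.range K)
    (s' := fun m => (Finset.Icc m (m + T)).filter (· < K))
    (by intro x y; simp only [Finset.mem_range, Finset.mem_Icc, Finset.mem_filter]; omega),
    Finset.mul_sum]
  refine Finset.sum_le_sum fun m _ => ?_
  rw [Finset.sum_const, nsmul_eq_mul]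
  refine mul_le_mul_of_nonneg_right ?_ (hβ m)
  have h := Finset.card_filter_le (Finset.Icc m (m + T)) (· < K)
  rw [Nat.card_Icc] at h
  exact_mod_cast (by omega : _ ≤ T + 1)

theorem tendsto_recentSum {α : ℕ → ℝ} (h : Tendsto α atTop (𝓝 0)) (T : ℕ) :
    Tendsto (recentSum α T) atTop (𝓝 0) := by
  rw [Metric.tendsto_atTop] at h ⊢
  intro e he
  obtain ⟨N, hN⟩ := h (e / (T + 2)) (by positivity)
  refine ⟨N + T, fun k hk => ?_⟩
  rw [Real.dist_eq, sub_zero]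
  calc |recentSum α T k| ≤ ∑ m ∈ Finset.Icc (k - T) k, |α m| := Finset.abs_sum_le_sum_abs _ _
    _ ≤ (Finset.Icc (k - T) k).card • (e / (T + 2)) :=
        Finset.sum_le_card_nsmul _ _ _ fun m hm => by
          have := hN m (by rw [Finset.mem_Icc] at hm; omega)
          rw [Real.dist_eq, sub_zero] at this
          exact this.le
    _ ≤ (T + 1) * (e / (T + 2)) := by
        rw [nsmul_eq_mul, Nat.card_Icc]
        gcongr
        exact_mod_cast (by omega : k + 1 - (k - T) ≤ T + 1)
    _ < e := by
        rw [← mul_div_assoc, div_lt_iff₀ (by positivity)]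
        nlinarith

/-- Summation of a delayed dissipation inequality. -/
theorem le_sub_of_delayed_dissipation {V α : ℕ → ℝ} {c C : ℝ} (hC : 0 ≤ C) (T : ℕ) (K : ℕ)
    (h : ∀ k < K, V (k + 1) ≤ V k - c * α k ^ 2 + C * recentSum α T k ^ 2) :
    V K ≤ V 0 - (c - C * (T + 1) ^ 2) * ∑ k ∈ Finset.range K, α k ^ 2 := by
  have h1 : V K ≤ V 0 - c * ∑ k ∈ Finset.range K, α k ^ 2 +
      C * ∑ k ∈ Finset.range K, recentSum α T k ^ 2 := by
    clear hC
    induction K with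
    | zero => simp
    | succ K ih =>
      rw [Finset.sum_range_succ, Finset.sum_range_succ]
      linarith [h K (by omega), ih fun k hk => h k (by omega)]
  -- One factor `T + 1` comes from Cauchy–Schwarz in each window, the other from counting windows.
  have h2 : ∑ k ∈ Finset.range K, recentSum α T k ^ 2 ≤
      (T + 1) ^ 2 * ∑ k ∈ Finset.range K, α k ^ 2 := by
    calc _ ≤ ∑ k ∈ Finset.range K, (T + 1) * recentSum (fun m => α m ^ 2) T k :=
          Finset.sum_le_sum fun k _ => recentSum_sq_le α T k
      _ ≤ (T + 1) * ((T + 1) * ∑ k ∈ Finset.range K, α k ^ 2) := by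
          rw [← Finset.mul_sum]
          gcongr
          exact sum_recentSum_le (fun m => sq_nonneg (α m)) T K
      _ = _ := by ring
  nlinarith [mul_le_mul_of_nonneg_left h2 hC]

/-! ### Flows over links -/

open Classical in
/-- The flow over the link `(i, j)` of the graph `H` at the state `z`. -/
noncomputable def linkFlow {n : ℕ} (f : Fin n → ℝ → ℝ) (W : Matrix (Fin n) (Fin n) ℝ) (a : ℝ)
    (H : SimpleGraph (Fin n)) (z : Fin n → ℝ) (i j : Fin n) : ℝ :=
  if H.Adj i j then a * W i j * sat (deriv (f i) (z i) - deriv (f j) (z j)) else 0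

section linkFlow

variable {n : ℕ} {f : Fin n → ℝ → ℝ} {W : Matrix (Fin n) (Fin n) ℝ} {a : ℝ}

theorem linkFlow_swap (hW : W.IsSymm) (H : SimpleGraph (Fin n)) (z : Fin n → ℝ) (i j : Fin n) :
    linkFlow f W a H z j i = -linkFlow f W a H z i j := by
  unfold linkFlow
  rw [H.adj_comm j i, hW.apply i j, ← neg_sub (deriv (f i) (z i)), sat_neg]
  split_ifs <;> ring

theorem abs_linkFlow_le (ha : 0 ≤ a) (hW : ∀ i j, 0 ≤ W i j) (H : SimpleGraph (Fin n))
    (z : Fin n → ℝ) (i j : Fin n) : |linkFlow f W a H z i j| ≤ a * W i j := by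
  have h := mul_nonneg ha (hW i j)
  unfold linkFlow
  split_ifs
  · rw [abs_mul, abs_of_nonneg h]
    exact mul_le_of_le_one_right h (abs_sat_le_one _)
  · simpa using h

theorem linkFlow_sq_le (ha : 0 ≤ a) (hW : ∀ i j, 0 ≤ W i j) {ε : ℝ} (hε : ∀ i j, a * W i j ≤ ε)
    (H : SimpleGraph (Fin n)) (z : Fin n → ℝ) (i j : Fin n) :
    linkFlow f W a H z i j ^ 2 ≤
      ε * (linkFlow f W a H z i j * (deriv (f i) (z i) - deriv (f j) (z j))) := by
  have h := mul_nonneg ha (hW i j)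
  unfold linkFlow
  split_ifs
  · generalize deriv (f i) (z i) - deriv (f j) (z j) = d
    have h1 := sat_sq_le d
    calc (a * W i j * sat d) ^ 2 = (a * W i j) * (a * W i j * sat d ^ 2) := by ring
      _ ≤ ε * (a * W i j * (sat d * d)) := by
          gcongr
          · exact h.trans (hε i j)
          · exact hε i j
      _ = _ := by ring
  · simp

theorem continuous_linkFlow (hf : ∀ i, RegularCost (f i)) (H : SimpleGraph (Fin n))
    {w : ℝ → Fin n → ℝ} (hw : ∀ i, Continuous fun θ => w θ i) (i j : Fin n) :
    Continuous fun θ => linkFlow f W a H (w θ) i j := by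
  unfold linkFlow
  split_ifs
  · exact continuous_const.mul (continuous_sat.comp
      (((hf i).2.2.continuous.comp (hw i)).sub ((hf j).2.2.continuous.comp (hw j))))
  · exact continuous_const

/-- Reindexes by the sending time `m = k - r` instead of the delay `r`. As delays never exceed `T`,
the cutoff at `T` can be dropped. -/
theorem delayedRate_eq {R η : ℝ} {T : ℕ} {G : ℕ → SimpleGraph (Fin n)}
    {τ : ℕ → Fin n → Fin n → ℕ} (hτ : ∀ k i j, τ k i j ≤ T) (z : ℕ → Fin n → ℝ) (k : ℕ)
    (i : Fin n) :
    delayedRate f W R η T G τ z k i = -∑ j, ∑ m ∈ Finset.range (k + 1),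
      if m + τ m i j = k then linkFlow f W (η * (R / maxRowSum W)) (G m) (z m) i j else 0 := by
  classical
  unfold delayedRate
  rw [neg_mul, Finset.mul_sum]
  congr 1
  refine Finset.sum_congr rfl fun j _ => ?_
  set F : ℕ → ℝ := fun r => if r ≤ k ∧ τ (k - r) i j = r then
    linkFlow f W (η * (R / maxRowSum W)) (G (k - r)) (z (k - r)) i j else 0 with hF
  have hleft : ∀ r, η * (R / maxRowSum W) * (if r ≤ k ∧ (G (k - r)).Adj i j then
      W i j * sat (deriv (f i) (z (k - r) i) - deriv (f j) (z (k - r) j)) *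
        delayIndicator τ (k - r) i j r else 0) = F r := fun r => by
    simp only [hF, linkFlow, delayIndicator]
    by_cases h1 : r ≤ k <;> by_cases h2 : (G (k - r)).Adj i j <;>
      by_cases h3 : τ (k - r) i j = r <;> simp only [h1, h2, h3, and_true, and_false,
        if_true, if_false, mul_zero, mul_one, mul_assoc]
  have hright : ∀ r ∈ Finset.range (k + 1), (if k + 1 - 1 - r + τ (k + 1 - 1 - r) i j = k then
      linkFlow f W (η * (R / maxRowSum W)) (G (k + 1 - 1 - r)) (z (k + 1 - 1 - r)) i j
      else 0) = F r := fun r hr => by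
    have hr' : r ≤ k := Nat.lt_succ_iff.1 (Finset.mem_range.1 hr)
    simp only [hF, Nat.add_sub_cancel]
    exact if_congr (by omega) rfl rfl
  rw [Finset.mul_sum, Finset.sum_congr rfl fun r _ => hleft r,
    ← Finset.sum_range_reflect _ (k + 1), Finset.sum_congr rfl hright,
    Finset.sum_subset (Finset.range_subset_range.2 (by omega : T + 1 ≤ T + k + 1)),
    Finset.sum_subset (Finset.range_subset_range.2 (by omega : k + 1 ≤ T + k + 1))]
  · intro r _ hr
    rw [Finset.mem_range] at hr
    exact if_neg (by omega)
  · intro r _ hr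
    rw [Finset.mem_range] at hr
    refine if_neg fun h => ?_
    have := hτ (k - r) i j
    omega

end linkFlow

/-! ### Transfers in one time unit and dissipation of the cost -/

/-- Net transfer over the link `(i, j)` in one time unit, with exchanged states `w θ`. -/
noncomputable def meanFlow {n : ℕ} (f : Fin n → ℝ → ℝ) (W : Matrix (Fin n) (Fin n) ℝ) (a : ℝ)
    (H : SimpleGraph (Fin n)) (w : ℝ → Fin n → ℝ) (i j : Fin n) : ℝ :=
  ∫ θ in (0 : ℝ)..1, linkFlow f W a H (w θ) i j

/-- Absolute transfer over the link `(i, j)` in one time unit. -/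
noncomputable def meanAbsFlow {n : ℕ} (f : Fin n → ℝ → ℝ) (W : Matrix (Fin n) (Fin n) ℝ) (a : ℝ)
    (H : SimpleGraph (Fin n)) (w : ℝ → Fin n → ℝ) (i j : Fin n) : ℝ :=
  ∫ θ in (0 : ℝ)..1, |linkFlow f W a H (w θ) i j|

/-- Absolute transfer over all links in one time unit. -/
noncomputable def totalFlow {n : ℕ} (f : Fin n → ℝ → ℝ) (W : Matrix (Fin n) (Fin n) ℝ) (a : ℝ)
    (H : SimpleGraph (Fin n)) (w : ℝ → Fin n → ℝ) : ℝ :=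
  ∑ i, ∑ j, meanAbsFlow f W a H w i j

section flow

variable {n : ℕ} {f : Fin n → ℝ → ℝ} {W : Matrix (Fin n) (Fin n) ℝ} {a : ℝ}

theorem meanFlow_swap (hW : W.IsSymm) (H : SimpleGraph (Fin n)) (w : ℝ → Fin n → ℝ)
    (i j : Fin n) : meanFlow f W a H w j i = -meanFlow f W a H w i j := by
  simp only [meanFlow, linkFlow_swap hW H _ i j, intervalIntegral.integral_neg]

theorem meanAbsFlow_nonneg (H : SimpleGraph (Fin n)) (w : ℝ → Fin n → ℝ) (i j : Fin n) :
    0 ≤ meanAbsFlow f W a H w i j :=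
  intervalIntegral.integral_nonneg zero_le_one fun _ _ => abs_nonneg _

theorem abs_meanFlow_le (H : SimpleGraph (Fin n)) (w : ℝ → Fin n → ℝ) (i j : Fin n) :
    |meanFlow f W a H w i j| ≤ meanAbsFlow f W a H w i j :=
  intervalIntegral.abs_integral_le_integral_abs zero_le_one

theorem meanAbsFlow_le (hf : ∀ i, RegularCost (f i)) (ha : 0 ≤ a) (hW : ∀ i j, 0 ≤ W i j)
    (H : SimpleGraph (Fin n)) {w : ℝ → Fin n → ℝ} (hw : ∀ i, Continuous fun θ => w θ i)
    (i j : Fin n) : meanAbsFlow f W a H w i j ≤ a * W i j := by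
  have h := intervalIntegral.integral_mono_on (μ := MeasureTheory.volume) zero_le_one
    ((continuous_linkFlow (W := W) (a := a) hf H hw i j).abs.intervalIntegrable 0 1)
    (intervalIntegrable_const (c := a * W i j))
    fun θ _ => abs_linkFlow_le ha hW H (w θ) i j
  simpa [meanAbsFlow] using h

theorem sum_meanAbsFlow_le_totalFlow (H : SimpleGraph (Fin n)) (w : ℝ → Fin n → ℝ)
    (i : Fin n) : ∑ j, meanAbsFlow f W a H w i j ≤ totalFlow f W a H w :=
  Finset.single_le_sum (f := fun i => ∑ j, meanAbsFlow f W a H w i j)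
    (fun i _ => Finset.sum_nonneg fun j _ => meanAbsFlow_nonneg H w i j) (Finset.mem_univ i)

theorem totalFlow_nonneg (H : SimpleGraph (Fin n)) (w : ℝ → Fin n → ℝ) :
    0 ≤ totalFlow f W a H w :=
  Finset.sum_nonneg fun i _ => Finset.sum_nonneg fun j _ => meanAbsFlow_nonneg H w i j

theorem abs_sum_meanFlow_le_totalFlow (H : SimpleGraph (Fin n)) (w : ℝ → Fin n → ℝ)
    (i : Fin n) : |∑ j, meanFlow f W a H w i j| ≤ totalFlow f W a H w :=
  (Finset.abs_sum_le_sum_abs _ _).trans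
    ((Finset.sum_le_sum fun j _ => abs_meanFlow_le H w i j).trans
      (sum_meanAbsFlow_le_totalFlow H w i))

theorem totalFlow_le (hf : ∀ i, RegularCost (f i)) (ha : 0 ≤ a) (hW : ∀ i j, 0 ≤ W i j)
    {ε : ℝ} (hε : ∀ i, ∑ j, a * W i j ≤ ε)
    (H : SimpleGraph (Fin n)) {w : ℝ → Fin n → ℝ} (hw : ∀ i, Continuous fun θ => w θ i) :
    totalFlow f W a H w ≤ n * ε := by
  calc totalFlow f W a H w ≤ ∑ _i : Fin n, ε := Finset.sum_le_sum fun i _ =>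
        (Finset.sum_le_sum fun j _ => meanAbsFlow_le hf ha hW H hw i j).trans (hε i)
    _ = n * ε := by simp

theorem totalFlow_sq_le (H : SimpleGraph (Fin n)) (w : ℝ → Fin n → ℝ) :
    totalFlow f W a H w ^ 2 ≤ (n : ℝ) ^ 2 * ∑ i, ∑ j, meanAbsFlow f W a H w i j ^ 2 := by
  have h := sq_sum_le_card_mul_sum_sq (s := (Finset.univ : Finset (Fin n × Fin n)))
    (f := fun p => meanAbsFlow f W a H w p.1 p.2)
  rw [Fintype.sum_prod_type, Fintype.sum_prod_type] at h
  simpa [totalFlow, sq] using h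

/-- Dissipation over a single link. -/
theorem le_meanFlow_mul (hf : ∀ i, RegularCost (f i)) (ha : 0 ≤ a) (hW : ∀ i j, 0 ≤ W i j)
    {ε : ℝ} (hε0 : 0 < ε) (hε : ∀ i j, a * W i j ≤ ε) (H : SimpleGraph (Fin n))
    {w : ℝ → Fin n → ℝ} (hw : ∀ i, Continuous fun θ => w θ i) {g : Fin n → ℝ} {d : ℝ}
    (hg : ∀ θ ∈ Set.Icc (0 : ℝ) 1, ∀ i, |deriv (f i) (w θ i) - g i| ≤ d) (i j : Fin n) :
    meanAbsFlow f W a H w i j ^ 2 / ε - 2 * d * meanAbsFlow f W a H w i j ≤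
      meanFlow f W a H w i j * (g i - g j) := by
  have hc := continuous_linkFlow (W := W) (a := a) hf H hw i j
  set A := meanAbsFlow f W a H w i j with hA
  have h := intervalIntegral.integral_mono_on (μ := MeasureTheory.volume)
    (f := fun θ => (2 * A / ε - 2 * d) * |linkFlow f W a H (w θ) i j| - A ^ 2 / ε)
    (g := fun θ => linkFlow f W a H (w θ) i j * (g i - g j)) zero_le_one
    (((hc.abs.const_mul _).sub continuous_const).intervalIntegrable 0 1)
    ((hc.mul_const _).intervalIntegrable 0 1) fun θ hθ => by
      have h1 := linkFlow_sq_le (f := f) ha hW hε H (w θ) i j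
      have h2 := abs_le.1 (hg θ hθ i)
      have h3 := abs_le.1 (hg θ hθ j)
      set u := linkFlow f W a H (w θ) i j
      have h4 : u * ((deriv (f i) (w θ i) - deriv (f j) (w θ j)) - (g i - g j)) ≤
          |u| * (2 * d) := by
        refine (le_abs_self _).trans ?_
        rw [abs_mul]
        gcongr
        exact abs_le.2 ⟨by linarith, by linarith⟩
      -- The square is replaced by its tangent at the mean `A`, which is linear in `|u|`;
      -- integrating then gives Jensen's inequality.
      have h5 : (2 * A * |u| - A ^ 2) / ε ≤
          u * (deriv (f i) (w θ i) - deriv (f j) (w θ j)) := by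
        rw [div_le_iff₀ hε0]
        nlinarith [sq_nonneg (|u| - A), sq_abs u]
      calc (2 * A / ε - 2 * d) * |u| - A ^ 2 / ε
          = (2 * A * |u| - A ^ 2) / ε - |u| * (2 * d) := by ring
        _ ≤ u * (g i - g j) := by nlinarith
  rw [intervalIntegral.integral_mul_const, intervalIntegral.integral_sub
    ((hc.abs.const_mul _).intervalIntegrable 0 1) intervalIntegrable_const,
    intervalIntegral.integral_const_mul, intervalIntegral.integral_const] at h
  have h6 : ∫ θ in (0 : ℝ)..1, |linkFlow f W a H (w θ) i j| = A := rfl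
  rw [h6] at h
  calc A ^ 2 / ε - 2 * d * A = (2 * A / ε - 2 * d) * A - ((1 : ℝ) - 0) • (A ^ 2 / ε) := by
        simp only [smul_eq_mul]; ring
    _ ≤ _ := h

/-- Change of the total cost under one unit of time of the undelayed transfers. -/
theorem sum_cost_step_le (hn : 0 < n) (hf : ∀ i, RegularCost (f i)) (ha : 0 ≤ a)
    (hWsymm : W.IsSymm) (hW : ∀ i j, 0 ≤ W i j) {ε : ℝ} (hε0 : 0 < ε)
    (hε : ∀ i j, a * W i j ≤ ε) (H : SimpleGraph (Fin n)) {w : ℝ → Fin n → ℝ}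
    (hw : ∀ i, Continuous fun θ => w θ i) {M L δ : ℝ} (hL : 0 ≤ L)
    (hlip : ∀ i x y, |x| ≤ M → |y| ≤ M → |deriv (f i) x - deriv (f i) y| ≤ L * |x - y|)
    {y y' : Fin n → ℝ} (hy : ∀ i, |y i| ≤ M) (hy' : ∀ i, y' i = y i - ∑ j, meanFlow f W a H w i j)
    (hy'M : ∀ i, |y' i| ≤ M) (hwM : ∀ θ ∈ Set.Icc (0 : ℝ) 1, ∀ i, |w θ i| ≤ M)
    (hwy : ∀ θ ∈ Set.Icc (0 : ℝ) 1, ∀ i, |w θ i - y i| ≤ 2 * δ)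
    (hδ : totalFlow f W a H w ≤ δ) :
    ∑ i, f i (y' i) ≤ ∑ i, f i (y i) - 1 / (2 * n ^ 2 * ε) * totalFlow f W a H w ^ 2 +
      (n + 2) * L * δ ^ 2 := by
  set U := meanFlow f W a H w with hU
  set A := meanAbsFlow f W a H w with hA
  set α := totalFlow f W a H w with hα
  set g : Fin n → ℝ := fun i => deriv (f i) (y i) with hg
  have hα0 : 0 ≤ α := totalFlow_nonneg H w
  have h1 : ∑ i, f i (y' i) ≤ ∑ i, (f i (y i) - g i * ∑ j, U i j + L * δ ^ 2) := by
    refine Finset.sum_le_sum fun i _ => ?_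
    have h := (hf i).le_of_lipschitz_deriv (hlip i) (hy i) (hy'M i)
    have h2 : (y' i - y i) ^ 2 ≤ δ ^ 2 := by
      rw [← sq_abs, hy' i, sub_sub_cancel_left, abs_neg]
      exact pow_le_pow_left₀ (abs_nonneg _)
        ((abs_sum_meanFlow_le_totalFlow H w i).trans hδ) 2
    have h3 : y' i - y i = -∑ j, U i j := by rw [hy' i]; ring
    have h4 := mul_le_mul_of_nonneg_left h2 hL
    rw [h3] at h h4
    linarith
  -- Symmetrization: each link is counted from both ends with opposite transfers.
  have h2 : ∑ i, g i * ∑ j, U i j = (∑ i, ∑ j, U i j * (g i - g j)) / 2 := by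
    have h3 : ∑ i, ∑ j, U i j * g j = -∑ i, ∑ j, U i j * g i := by
      rw [Finset.sum_comm, ← Finset.sum_neg_distrib]
      refine Finset.sum_congr rfl fun j _ => ?_
      rw [← Finset.sum_neg_distrib]
      exact Finset.sum_congr rfl fun i _ => by rw [hU, meanFlow_swap hWsymm]; ring
    have h4 : ∑ i, g i * ∑ j, U i j = ∑ i, ∑ j, U i j * g i :=
      Finset.sum_congr rfl fun i _ => by rw [Finset.mul_sum]; simp only [mul_comm]
    simp only [mul_sub, Finset.sum_sub_distrib, h3, h4]
    ring
  -- Exchanged states are within `2 * δ` of `y`, so gradients are off by at most `2 * L * δ` at each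
  -- end of a link. After halving, this yields the `2` in `n + 2`; the `n` is the second-order term
  -- summed over nodes.
  have h3 : (∑ i, ∑ j, A i j ^ 2) / ε - 4 * L * δ * α ≤ ∑ i, ∑ j, U i j * (g i - g j) := by
    have h4 : ∀ i j, A i j ^ 2 / ε - 2 * (2 * L * δ) * A i j ≤ U i j * (g i - g j) :=
      le_meanFlow_mul hf ha hW hε0 hε H hw fun θ hθ i => by
        calc _ ≤ L * |w θ i - y i| := hlip i _ _ (hwM θ hθ i) (hy i)
          _ ≤ L * (2 * δ) := by gcongr; exact hwy θ hθ i
          _ = 2 * L * δ := by ring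
    refine le_trans (le_of_eq ?_) (Finset.sum_le_sum fun i _ => Finset.sum_le_sum fun j _ => h4 i j)
    simp only [Finset.sum_sub_distrib, ← Finset.mul_sum, ← Finset.sum_div]
    rw [hα, totalFlow]
    ring
  have h4 : 1 / (2 * n ^ 2 * ε) * α ^ 2 ≤ (∑ i, ∑ j, A i j ^ 2) / ε / 2 := by
    have hn' : (0 : ℝ) < n := Nat.cast_pos.2 hn
    have h5 := totalFlow_sq_le (f := f) (W := W) (a := a) H w
    rw [one_div, inv_mul_le_iff₀ (by positivity)]
    calc α ^ 2 ≤ (n : ℝ) ^ 2 * ∑ i, ∑ j, A i j ^ 2 := h5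
      _ = _ := by field_simp
  have h5 : L * δ * α ≤ L * δ ^ 2 := by
    rw [sq, ← mul_assoc]
    exact mul_le_mul_of_nonneg_left hδ (mul_nonneg hL (hα0.trans hδ))
  rw [Finset.sum_add_distrib, Finset.sum_sub_distrib, h2, Finset.sum_const, Finset.card_univ,
    Fintype.card_fin, nsmul_eq_mul] at h1
  nlinarith

end flow

/-! ### Averaged trajectories and their undelayed companions -/

/-- Trajectories `x` at integer times whose increments are averages of the delayed update over the
exchanged states `w k θ`, `0 ≤ θ ≤ 1`. -/
structure IsAveragedTrajectory {n : ℕ} (f : Fin n → ℝ → ℝ) (W : Matrix (Fin n) (Fin n) ℝ)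
    (R η : ℝ) (T : ℕ) (G : ℕ → SimpleGraph (Fin n)) (τ : ℕ → Fin n → Fin n → ℕ)
    (x : ℕ → Fin n → ℝ) (w : ℕ → ℝ → Fin n → ℝ) : Prop where
  continuous : ∀ k i, Continuous fun θ => w k θ i
  step : ∀ k i, x (k + 1) i =
    x k i + ∫ θ in (0 : ℝ)..1, delayedRate f W R η T G τ (fun m => w m θ) k i
  close : ∀ k, ∀ θ ∈ Set.Icc (0 : ℝ) 1, ∀ i, |w k θ i - x k i| ≤
    ∫ θ in (0 : ℝ)..1, |delayedRate f W R η T G τ (fun m => w m θ) k i|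

section trajectory

variable {n : ℕ} {f : Fin n → ℝ → ℝ} {W : Matrix (Fin n) (Fin n) ℝ} {R η : ℝ} {T : ℕ}
  {G : ℕ → SimpleGraph (Fin n)} {τ : ℕ → Fin n → Fin n → ℕ}

theorem continuous_delayedRate (hf : ∀ i, RegularCost (f i)) (hτ : ∀ k i j, τ k i j ≤ T)
    {w : ℕ → ℝ → Fin n → ℝ} (hw : ∀ k i, Continuous fun θ => w k θ i) (k : ℕ) (i : Fin n) :
    Continuous fun θ => delayedRate f W R η T G τ (fun m => w m θ) k i := by
  simp only [delayedRate_eq hτ]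
  refine (continuous_finsetSum _ fun j _ => continuous_finsetSum _ fun m _ => ?_).neg
  split_ifs
  · exact continuous_linkFlow hf (G m) (hw m) i j
  · exact continuous_const

/-- Sums of delayed transfers into one node are bounded by recent absolute transfers. -/
theorem sum_delayed_le_recentSum {b : ℕ → Fin n → ℝ} (hb : ∀ m j, 0 ≤ b m j) {α : ℕ → ℝ}
    (hα : ∀ m, ∑ j, b m j ≤ α m) {k s : ℕ} (hs : s ≤ k + 1) {p : ℕ → Fin n → Prop}
    [∀ m j, Decidable (p m j)] (hp : ∀ m j, p m j → k ≤ m + T) :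
    ∑ j, ∑ m ∈ Finset.range s, (if p m j then b m j else 0) ≤ recentSum α T k := by
  rw [Finset.sum_comm]
  calc ∑ m ∈ Finset.range s, ∑ j, (if p m j then b m j else 0)
      ≤ ∑ m ∈ Finset.range s, if k ≤ m + T then ∑ j, b m j else 0 := by
        refine Finset.sum_le_sum fun m _ => ?_
        by_cases h : k ≤ m + T
        · rw [if_pos h]
          refine Finset.sum_le_sum fun j _ => ?_
          split_ifs
          exacts [le_rfl, hb m j]
        · rw [if_neg h]
          exact Finset.sum_nonpos fun j _ => by rw [if_neg fun h' => h (hp m j h')]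
    _ = ∑ m ∈ (Finset.range s).filter (fun m => k ≤ m + T), ∑ j, b m j :=
        (Finset.sum_filter _ _).symm
    _ ≤ ∑ m ∈ Finset.Icc (k - T) k, ∑ j, b m j := by
        refine Finset.sum_le_sum_of_subset_of_nonneg (fun m hm => ?_)
          fun m _ _ => Finset.sum_nonneg fun j _ => hb m j
        simp only [Finset.mem_filter, Finset.mem_range, Finset.mem_Icc] at *
        omega
    _ ≤ recentSum α T k := Finset.sum_le_sum fun m _ => hα m

theorem integral_delayedRate (hf : ∀ i, RegularCost (f i)) (hτ : ∀ k i j, τ k i j ≤ T)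
    {w : ℕ → ℝ → Fin n → ℝ} (hw : ∀ k i, Continuous fun θ => w k θ i) (k : ℕ) (i : Fin n) :
    ∫ θ in (0 : ℝ)..1, delayedRate f W R η T G τ (fun m => w m θ) k i =
      -∑ j, ∑ m ∈ Finset.range (k + 1), if m + τ m i j = k then
        meanFlow f W (η * (R / maxRowSum W)) (G m) (w m) i j else 0 := by
  have hc : ∀ j m, Continuous fun θ => if m + τ m i j = k then
      linkFlow f W (η * (R / maxRowSum W)) (G m) (w m θ) i j else 0 := fun j m => by
    split_ifs
    · exact continuous_linkFlow hf (G m) (hw m) i j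
    · exact continuous_const
  simp only [delayedRate_eq hτ]
  rw [intervalIntegral.integral_neg, intervalIntegral.integral_finsetSum fun j _ =>
    (continuous_finsetSum _ fun m _ => hc j m).intervalIntegrable 0 1]
  congr 1
  refine Finset.sum_congr rfl fun j _ => ?_
  rw [intervalIntegral.integral_finsetSum fun m _ => (hc j m).intervalIntegrable 0 1]
  refine Finset.sum_congr rfl fun m _ => ?_
  split_ifs
  · rfl
  · simp

theorem integral_abs_delayedRate_le (hf : ∀ i, RegularCost (f i)) (hτ : ∀ k i j, τ k i j ≤ T)
    {w : ℕ → ℝ → Fin n → ℝ} (hw : ∀ k i, Continuous fun θ => w k θ i) (k : ℕ) (i : Fin n) :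
    ∫ θ in (0 : ℝ)..1, |delayedRate f W R η T G τ (fun m => w m θ) k i| ≤
      recentSum (fun m => totalFlow f W (η * (R / maxRowSum W)) (G m) (w m)) T k := by
  have hc : ∀ m j, Continuous fun θ =>
      |linkFlow f W (η * (R / maxRowSum W)) (G m) (w m θ) i j| := fun m j =>
    (continuous_linkFlow hf (G m) (hw m) i j).abs
  have h := intervalIntegral.integral_mono_on (μ := MeasureTheory.volume)
    (f := fun θ => |delayedRate f W R η T G τ (fun m => w m θ) k i|)
    (g := fun θ => recentSum (fun m => ∑ j,
      |linkFlow f W (η * (R / maxRowSum W)) (G m) (w m θ) i j|) T k) zero_le_one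
    ((continuous_delayedRate hf hτ hw k i).abs.intervalIntegrable 0 1)
    ((continuous_finsetSum _ fun m _ =>
      continuous_finsetSum _ fun j _ => hc m j).intervalIntegrable 0 1) fun θ _ => by
      rw [delayedRate_eq hτ, abs_neg]
      refine (Finset.abs_sum_le_sum_abs _ _).trans ((Finset.sum_le_sum fun j _ =>
        (Finset.abs_sum_le_sum_abs _ _)).trans ?_)
      simp only [apply_ite abs, abs_zero]
      exact sum_delayed_le_recentSum (fun m j => abs_nonneg _) (fun m => le_rfl) le_rfl
        fun m j hm => by have := hτ m i j; omega
  refine h.trans ?_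
  unfold recentSum
  rw [intervalIntegral.integral_finsetSum fun m _ =>
    (continuous_finsetSum _ fun j _ => hc m j).intervalIntegrable 0 1]
  refine Finset.sum_le_sum fun m _ => ?_
  rw [intervalIntegral.integral_finsetSum fun j _ => (hc m j).intervalIntegrable 0 1]
  exact sum_meanAbsFlow_le_totalFlow (G m) (w m) i

/-- The state obtained from `x 0` by performing all transfers without delay. -/
noncomputable def undelayedState (f : Fin n → ℝ → ℝ) (W : Matrix (Fin n) (Fin n) ℝ) (a : ℝ)
    (G : ℕ → SimpleGraph (Fin n)) (x₀ : Fin n → ℝ) (w : ℕ → ℝ → Fin n → ℝ) (k : ℕ)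
    (i : Fin n) : ℝ :=
  x₀ i - ∑ j, ∑ m ∈ Finset.range k, meanFlow f W a (G m) (w m) i j

theorem undelayedState_succ {a : ℝ} (x₀ : Fin n → ℝ) (w : ℕ → ℝ → Fin n → ℝ) (k : ℕ)
    (i : Fin n) : undelayedState f W a G x₀ w (k + 1) i =
      undelayedState f W a G x₀ w k i - ∑ j, meanFlow f W a (G k) (w k) i j := by
  simp only [undelayedState, Finset.sum_range_succ, Finset.sum_add_distrib]
  ring

/-- Both directions of a link are booked at the same time and cancel. The actual state lacks this
invariant when the two delays differ. -/
theorem sum_undelayedState (hW : W.IsSymm) {a : ℝ} (x₀ : Fin n → ℝ) (w : ℕ → ℝ → Fin n → ℝ)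
    (k : ℕ) : ∑ i, undelayedState f W a G x₀ w k i = ∑ i, x₀ i := by
  have h : ∑ i, ∑ j, ∑ m ∈ Finset.range k, meanFlow f W a (G m) (w m) i j = 0 := by
    have h1 : ∑ i, ∑ j, ∑ m ∈ Finset.range k, meanFlow f W a (G m) (w m) i j =
        -∑ i, ∑ j, ∑ m ∈ Finset.range k, meanFlow f W a (G m) (w m) i j := by
      conv_lhs => rw [Finset.sum_comm]
      simp only [← Finset.sum_neg_distrib]
      exact Finset.sum_congr rfl fun i _ => Finset.sum_congr rfl fun j _ =>
        Finset.sum_congr rfl fun m _ => meanFlow_swap hW (G m) (w m) i j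
    linarith
  simp only [undelayedState, Finset.sum_sub_distrib, h, sub_zero]

theorem IsAveragedTrajectory.abs_sub_undelayedState_le (hf : ∀ i, RegularCost (f i))
    (hτ : ∀ k i j, τ k i j ≤ T) {x : ℕ → Fin n → ℝ} {w : ℕ → ℝ → Fin n → ℝ}
    (hx : IsAveragedTrajectory f W R η T G τ x w) (k : ℕ) (i : Fin n) :
    |x k i - undelayedState f W (η * (R / maxRowSum W)) G (x 0) w k i| ≤
      recentSum (fun m => totalFlow f W (η * (R / maxRowSum W)) (G m) (w m)) T k := by
  set a := η * (R / maxRowSum W)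
  -- The difference consists of the transfers in flight: data sent at `m` enters the update from `m
  -- + τ m i j` to its successor, so it is pending at `k` exactly when `m < k ≤ m + τ m i j`.
  have h : x k i - undelayedState f W a G (x 0) w k i =
      ∑ j, ∑ m ∈ Finset.range k,
        if k ≤ m + τ m i j then meanFlow f W a (G m) (w m) i j else 0 := by
    induction k with
    | zero => simp [undelayedState]
    | succ k ih =>
      rw [hx.step, undelayedState_succ, integral_delayedRate hf hτ hx.continuous]
      have h1 : ∀ j, ∑ m ∈ Finset.range (k + 1),
          (if k + 1 ≤ m + τ m i j then meanFlow f W a (G m) (w m) i j else 0) =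
          ∑ m ∈ Finset.range k,
            (if k ≤ m + τ m i j then meanFlow f W a (G m) (w m) i j else 0) +
          meanFlow f W a (G k) (w k) i j -
          ∑ m ∈ Finset.range (k + 1),
            (if m + τ m i j = k then meanFlow f W a (G m) (w m) i j else 0) := fun j => by
        have h2 : meanFlow f W a (G k) (w k) i j =
            if k ≤ k + τ k i j then meanFlow f W a (G k) (w k) i j else 0 := by simp
        rw [h2, ← Finset.sum_range_succ (fun m => if k ≤ m + τ m i j then
          meanFlow f W a (G m) (w m) i j else 0), ← Finset.sum_sub_distrib]
        refine Finset.sum_congr rfl fun m _ => ?_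
        split_ifs <;> first | omega | simp
      simp only [h1, Finset.sum_sub_distrib, Finset.sum_add_distrib, ← ih]
      ring
  rw [h]
  refine (Finset.abs_sum_le_sum_abs _ _).trans ((Finset.sum_le_sum fun j _ =>
    (Finset.abs_sum_le_sum_abs _ _)).trans ?_)
  refine le_trans (Finset.sum_le_sum fun j _ => Finset.sum_le_sum fun m _ => ?_)
    (sum_delayed_le_recentSum (T := T) (p := fun m j => k ≤ m + τ m i j)
      (b := fun m j => meanAbsFlow f W a (G m) (w m) i j)
      (fun m j => meanAbsFlow_nonneg (G m) (w m) i j)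
      (fun m => sum_meanAbsFlow_le_totalFlow (G m) (w m) i) (Nat.le_succ k)
      fun m j hm => by have := hτ m i j; omega)
  split_ifs
  · exact abs_meanFlow_le (G m) (w m) i j
  · simp

/-- One window bounds the transfers in flight, the other the drift within the time unit. -/
theorem IsAveragedTrajectory.abs_exchanged_sub_undelayedState_le (hf : ∀ i, RegularCost (f i))
    (hτ : ∀ k i j, τ k i j ≤ T) {x : ℕ → Fin n → ℝ} {w : ℕ → ℝ → Fin n → ℝ}
    (hx : IsAveragedTrajectory f W R η T G τ x w) (k : ℕ) {θ : ℝ} (hθ : θ ∈ Set.Icc (0 : ℝ) 1)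
    (i : Fin n) :
    |w k θ i - undelayedState f W (η * (R / maxRowSum W)) G (x 0) w k i| ≤
      2 * recentSum (fun m => totalFlow f W (η * (R / maxRowSum W)) (G m) (w m)) T k := by
  have h1 := (hx.close k θ hθ i).trans (integral_abs_delayedRate_le hf hτ hx.continuous k i)
  have h2 := hx.abs_sub_undelayedState_le hf hτ k i
  rw [two_mul]
  exact (abs_sub_le _ (x k i) _).trans (add_le_add h1 h2)

end trajectory

/-! ### Consensus over uniformly connected graphs -/

theorem abs_sub_le_of_walk {V : Type*} {H : SimpleGraph V} {g : V → ℝ} {e : ℝ}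
    (h : ∀ i j, H.Adj i j → |g i - g j| ≤ e) {i j : V} (p : H.Walk i j) :
    |g i - g j| ≤ p.length * e := by
  induction p with
  | nil => simp
  | cons hadj p ih =>
    rw [SimpleGraph.Walk.length_cons]
    push_cast
    have h1 := abs_sub_le (g _) (g _) (g _) |>.trans (add_le_add (h _ _ hadj) ih)
    linarith

/-- Slowly varying signals that agree asymptotically over the present links reach consensus. -/
theorem tendsto_sub_of_uniformlyConnected {n : ℕ} {G : ℕ → SimpleGraph (Fin n)} {B : ℕ}
    (hG : UniformlyConnected G B) {g : ℕ → Fin n → ℝ} {e : ℕ → ℝ} (he : Tendsto e atTop (𝓝 0))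
    (hadj : ∀ᶠ k in atTop, ∀ i j, (G k).Adj i j → |g k i - g k j| ≤ e k)
    (hslow : ∀ k i, |g (k + 1) i - g k i| ≤ e k) (i j : Fin n) :
    Tendsto (fun k => g k i - g k j) atTop (𝓝 0) := by
  rw [Metric.tendsto_atTop]
  intro ε hε
  -- A path has at most `n` edges. Each costs `d` when its link is present plus a drift of at most
  -- `B * d` at either end; the final `+ 1` makes the bound strict.
  have hd : 0 < ε / (n * (2 * B + 1) + 1) := by positivity
  set d := ε / (n * (2 * B + 1) + 1) with hd'
  obtain ⟨N, hN⟩ := eventually_atTop.1 (hadj.and (he.eventually (gt_mem_nhds hd)))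
  refine ⟨N, fun t ht => ?_⟩
  rw [Real.dist_eq, sub_zero]
  have hvar : ∀ s i, |g (t + s) i - g t i| ≤ s * d := by
    intro s i
    induction s with
    | zero => simp
    | succ s ih =>
      have h1 := (hslow (t + s) i).trans (hN (t + s) (by omega)).2.le
      push_cast
      have h2 := (abs_sub_le (g (t + s + 1) i) (g (t + s) i) (g t i)).trans (add_le_add h1 ih)
      rw [← add_assoc]
      linarith
  have hedge : ∀ i j, (⨆ k ∈ Set.Icc t (t + B), G k).Adj i j →
      |g t i - g t j| ≤ (2 * B + 1) * d := by
    intro i j hij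
    simp only [SimpleGraph.iSup_adj] at hij
    obtain ⟨k, hk, hkij⟩ := hij
    obtain ⟨s, rfl⟩ := Nat.exists_eq_add_of_le hk.1
    have hs : (s : ℝ) * d ≤ B * d := by
      have : s ≤ B := by have := hk.2; omega
      gcongr
    have h1 := ((hN (t + s) (by omega)).1 i j hkij).trans (hN (t + s) (by omega)).2.le
    have h2 := abs_le.1 ((hvar s i).trans hs)
    have h3 := abs_le.1 ((hvar s j).trans hs)
    have h4 := abs_le.1 h1
    exact abs_le.2 ⟨by linarith, by linarith⟩
  obtain ⟨p, hp⟩ := ((hG t).preconnected i j).exists_isPath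
  have hlen : (p.length : ℝ) ≤ n := by
    have := hp.length_lt
    rw [Fintype.card_fin] at this
    exact_mod_cast this.le
  calc |g t i - g t j| ≤ p.length * ((2 * B + 1) * d) := abs_sub_le_of_walk hedge p
    _ ≤ n * ((2 * B + 1) * d) := by gcongr
    _ < (n * (2 * B + 1) + 1) * d := by linarith
    _ = ε := by rw [hd']; field_simp

/-! ### Bounds on the link gains -/

section weights

variable {n : ℕ} {W : Matrix (Fin n) (Fin n) ℝ}

theorem sum_row_le_maxRowSum (i : Fin n) : ∑ j, W i j ≤ maxRowSum W :=
  le_ciSup (f := fun i => ∑ j, W i j) (Set.finite_range _).bddAbove i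

theorem maxRowSum_nonneg (hW : ∀ i j, 0 ≤ W i j) : 0 ≤ maxRowSum W :=
  Real.iSup_nonneg fun i => Finset.sum_nonneg fun j _ => hW i j

theorem sum_gain_mul_le {R η : ℝ} (hR : 0 ≤ R) (hη : 0 ≤ η) (hW : ∀ i j, 0 ≤ W i j)
    (i : Fin n) : ∑ j, η * (R / maxRowSum W) * W i j ≤ η * R := by
  rw [← Finset.mul_sum, mul_assoc, div_mul_eq_mul_div, mul_div_assoc]
  have h : (∑ j, W i j) / maxRowSum W ≤ 1 :=
    div_le_one_of_le₀ (sum_row_le_maxRowSum i) (maxRowSum_nonneg hW)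
  exact mul_le_mul_of_nonneg_left (mul_le_of_le_one_right hR h) hη

/-- There are only finitely many links, and `maxRowSum W` is positive as soon as one weight is. -/
theorem exists_pos_le_gain_mul {R η : ℝ} (hR : 0 < R) (hη : 0 < η) (hW : ∀ i j, 0 ≤ W i j) :
    ∃ κ : ℝ, 0 < κ ∧ ∀ i j, 0 < W i j → κ ≤ η * (R / maxRowSum W) * W i j := by
  have h : ∀ᶠ u in 𝓝[>] (0 : ℝ), ∀ i j, 0 < W i j → u ≤ η * (R / maxRowSum W) * W i j := by
    refine eventually_all.2 fun i => eventually_all.2 fun j => ?_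
    by_cases hij : 0 < W i j
    · have h1 : 0 < maxRowSum W := hij.trans_le
        ((Finset.single_le_sum (fun j _ => hW i j) (Finset.mem_univ j)).trans
          (sum_row_le_maxRowSum i))
      have h2 : 0 < η * (R / maxRowSum W) * W i j := by positivity
      exact mem_of_superset (Ioo_mem_nhdsGT h2) fun u hu _ => hu.2.le
    · exact Eventually.of_forall fun u h => absurd h hij
  obtain ⟨u, hu, hu0⟩ := (h.and self_mem_nhdsWithin).exists
  exact ⟨u, hu0, hu⟩

end weights

/-! ### From vanishing flows to convergence -/

/-- Small transfers over a link force nearly equal marginal costs at its ends. -/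
theorem gain_mul_abs_sat_le {n : ℕ} {f : Fin n → ℝ → ℝ} {W : Matrix (Fin n) (Fin n) ℝ} {a : ℝ}
    (hf : ∀ i, RegularCost (f i)) (ha : 0 ≤ a) (hW : ∀ i j, 0 ≤ W i j)
    {H : SimpleGraph (Fin n)} {w : ℝ → Fin n → ℝ} (hw : ∀ i, Continuous fun θ => w θ i)
    {g : Fin n → ℝ} {d : ℝ}
    (hg : ∀ θ ∈ Set.Icc (0 : ℝ) 1, ∀ i, |deriv (f i) (w θ i) - g i| ≤ d) {i j : Fin n}
    (hij : H.Adj i j) :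
    a * W i j * |sat (g i - g j)| ≤ meanAbsFlow f W a H w i j + a * W i j * (2 * d) := by
  have hc := continuous_linkFlow (W := W) (a := a) hf H hw i j
  have haW := mul_nonneg ha (hW i j)
  have h := intervalIntegral.integral_mono_on (μ := MeasureTheory.volume)
    (f := fun _ => a * W i j * |sat (g i - g j)|)
    (g := fun θ => |linkFlow f W a H (w θ) i j| + a * W i j * (2 * d)) zero_le_one
    intervalIntegrable_const ((hc.abs.add continuous_const).intervalIntegrable 0 1) fun θ hθ => by
      have h2 := abs_le.1 (hg θ hθ i)
      have h3 := abs_le.1 (hg θ hθ j)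
      rw [linkFlow, if_pos hij, abs_mul, abs_of_nonneg haW, ← mul_add]
      refine mul_le_mul_of_nonneg_left ?_ haW
      have h4 := abs_sat_sub_sat_le (g i - g j) (deriv (f i) (w θ i) - deriv (f j) (w θ j))
      have h5 : |g i - g j - (deriv (f i) (w θ i) - deriv (f j) (w θ j))| ≤ 2 * d :=
        abs_le.2 ⟨by linarith, by linarith⟩
      have h6 := abs_sub_abs_le_abs_sub (sat (g i - g j))
        (sat (deriv (f i) (w θ i) - deriv (f j) (w θ j)))
      linarith
  rw [intervalIntegral.integral_add (hc.abs.intervalIntegrable 0 1) intervalIntegrable_const] at h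
  simpa [meanAbsFlow] using h

/-- Consensus of the marginal costs along bounded allocations of the optimal total power implies
convergence to the optimum. -/
theorem tendsto_of_marginal_consensus {n : ℕ} (hn : 0 < n) {f : Fin n → ℝ → ℝ} {v : ℝ}
    (hv0 : 0 < v) (hv : ∀ i x y, f i x + deriv (f i) x * (y - x) + v / 2 * (y - x) ^ 2 ≤ f i y)
    {z : Fin n → ℝ} {l : ℝ} (hz : ∀ i, deriv (f i) (z i) = l) {y : ℕ → Fin n → ℝ}
    (hsum : ∀ k, ∑ i, y k i = ∑ i, z i) {D : ℝ} (hD : ∀ k i, |y k i - z i| ≤ D)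
    (hcons : ∀ i j, Tendsto (fun k => deriv (f i) (y k i) - deriv (f j) (y k j)) atTop (𝓝 0)) :
    Tendsto y atTop (𝓝 z) := by
  set o : Fin n := ⟨0, hn⟩
  have hbound : ∀ k i, (y k i - z i) ^ 2 ≤
      (∑ i, |deriv (f i) (y k i) - deriv (f o) (y k o)| * D) / v := by
    intro k i
    rw [le_div_iff₀ hv0]
    calc (y k i - z i) ^ 2 * v
        ≤ (∑ i, (y k i - z i) ^ 2) * v := by
          gcongr
          exact Finset.single_le_sum (fun i _ => sq_nonneg (y k i - z i)) (Finset.mem_univ i)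
      _ ≤ ∑ i, (deriv (f i) (y k i) - l) * (y k i - z i) := by
          rw [Finset.sum_mul]
          refine Finset.sum_le_sum fun i _ => ?_
          rw [← hz i]
          nlinarith [hv i (z i) (y k i), hv i (y k i) (z i)]
      _ = ∑ i, (deriv (f i) (y k i) - deriv (f o) (y k o)) * (y k i - z i) := by
          -- The deviations `y k i - z i` sum to zero, so `l` may be replaced by the marginal cost
          -- at the reference node `o`.
          have h1 : ∑ i, (deriv (f o) (y k o) - l) * (y k i - z i) = 0 := by
            rw [← Finset.mul_sum, Finset.sum_sub_distrib, hsum, sub_self, mul_zero]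
          rw [← sub_eq_zero, ← Finset.sum_sub_distrib, ← h1]
          exact Finset.sum_congr rfl fun i _ => by ring
      _ ≤ ∑ i, |deriv (f i) (y k i) - deriv (f o) (y k o)| * D := by
          refine Finset.sum_le_sum fun i _ => (le_abs_self _).trans ?_
          rw [abs_mul]
          gcongr
          exact hD k i
  have hlim : Tendsto (fun k => (∑ i, |deriv (f i) (y k i) - deriv (f o) (y k o)| * D) / v)
      atTop (𝓝 0) := by
    have h := (tendsto_finsetSum (Finset.univ : Finset (Fin n)) fun i _ =>
      ((hcons i o).abs.mul_const D)).div_const v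
    simpa using h
  refine tendsto_pi_nhds.2 fun i => ?_
  have h1 : Tendsto (fun k => (y k i - z i) ^ 2) atTop (𝓝 0) :=
    squeeze_zero (fun k => sq_nonneg _) (fun k => hbound k i) hlim
  have h2 : Tendsto (fun k => |y k i - z i|) atTop (𝓝 0) := by
    simpa [Real.sqrt_sq_eq_abs] using h1.sqrt
  exact tendsto_sub_nhds_zero_iff.1 ((tendsto_zero_iff_abs_tendsto_zero _).2 h2)

/-- Convergence of averaged trajectories for small steps. -/
theorem exists_step_tendsto_averaged {n : ℕ} (hn : 0 < n) {f : Fin n → ℝ → ℝ}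
    (hf : ∀ i, RegularCost (f i)) {R : ℝ} (hR : 0 < R) {W : Matrix (Fin n) (Fin n) ℝ}
    (hWsymm : W.IsSymm) (hW : ∀ i j, 0 ≤ W i j) (T : ℕ) {z : Fin n → ℝ} {l : ℝ}
    (hz : ∀ i, deriv (f i) (z i) = l) (ρ : ℝ) :
    ∃ η₀ : ℝ, 0 < η₀ ∧ ∀ η : ℝ, 0 < η → η ≤ η₀ →
      ∀ (B : ℕ) (G : ℕ → SimpleGraph (Fin n)) (τ : ℕ → Fin n → Fin n → ℕ),
        (∀ k i j, (G k).Adj i j → 0 < W i j) → UniformlyConnected G B →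
        (∀ k i j, τ k i j ≤ T) → ∀ x w, IsAveragedTrajectory f W R η T G τ x w →
          ∑ i, x 0 i = ∑ i, z i → (∀ i, |x 0 i| ≤ ρ) →
          Tendsto x atTop (𝓝 z) ∧ ∀ i, Tendsto (fun k => ∫ θ in (0 : ℝ)..1,
            |delayedRate f W R η T G τ (fun m => w m θ) k i|) atTop (𝓝 0) := by
  obtain ⟨v, hv0, hv⟩ := exists_tangent_le_uniform hf
  have hC : ∀ i, ∃ C, ∀ s ∈ Set.Icc (-ρ) ρ, ‖f i s‖ ≤ C := fun i =>
    isCompact_Icc.exists_bound_of_continuousOn (hf i).2.1.continuous.continuousOn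
  choose C hC using hC
  -- Allocations costing at most `∑ i, C i`, a bound for every admissible initial cost, satisfy `(y
  -- i - z i) ^ 2 ≤ D - 1`, which implies `|y i - z i| ≤ D`.
  set D := max 0 (2 / v * (∑ i, C i - ∑ i, f i (z i))) + 1 with hD
  have hD1 : 1 ≤ D := by rw [hD]; linarith [le_max_left 0 (2 / v * (∑ i, C i - ∑ i, f i (z i)))]
  have hsub : ∀ y : Fin n → ℝ, ∑ i, y i = ∑ i, z i → ∑ i, f i (y i) ≤ ∑ i, C i →
      ∀ i, |y i - z i| ≤ D := by
    intro y hy hyC i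
    have h1 := sum_add_sq_le_of_equal_marginal_costs hv hz hy
    have h2 := Finset.single_le_sum (fun i _ => sq_nonneg (y i - z i)) (Finset.mem_univ i)
    have h3 : (y i - z i) ^ 2 ≤ D - 1 := by
      rw [hD, add_sub_cancel_right]
      refine le_max_of_le_right ?_
      rw [div_mul_eq_mul_div, le_div_iff₀ hv0]
      nlinarith
    rw [← sq_abs] at h3
    nlinarith [abs_nonneg (y i - z i)]
  -- The extra unit leaves room for the exchanged states and the next iterate, where the Lipschitz
  -- bound is also needed.
  set M := ∑ i, |z i| + D + 1 with hM
  have hMy : ∀ y : Fin n → ℝ, (∀ i, |y i - z i| ≤ D) → ∀ i, |y i| ≤ M - 1 := by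
    intro y hy i
    have h1 := Finset.single_le_sum (fun i _ => abs_nonneg (z i)) (Finset.mem_univ i)
    have h2 := abs_sub_abs_le_abs_sub (y i) (z i)
    linarith [hy i]
  obtain ⟨L, hL, hlip⟩ := exists_lipschitz_deriv_uniform hf M
  set c := (n + 2) * L with hc
  have hc0 : 0 ≤ c := by positivity
  have hn' : (0 : ℝ) < n := Nat.cast_pos.2 hn
  -- The first summand keeps the recent flow below `1 / 2`; the second makes the dissipation exceed
  -- the summed delay error by a factor of at least `1` times the squared flow.
  set Q := 2 * (T + 1) * n + 2 * n ^ 2 * (1 + c * (T + 1) ^ 2) with hQ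
  have hQ0 : 0 < Q := by positivity
  refine ⟨1 / (Q * R), by positivity, fun η hη hη₀ B G τ hGW hG hτ x w hx hx0 hxρ => ?_⟩
  set ε := η * R with hε
  have hε0 : 0 < ε := mul_pos hη hR
  have hQε : Q * ε ≤ 1 := by
    rw [le_div_iff₀ (by positivity)] at hη₀
    rw [hε]
    linarith
  have hε1 : (T + 1) * (n * ε) ≤ 1 / 2 := by
    have h1 : 0 ≤ 2 * (n : ℝ) ^ 2 * (1 + c * (T + 1) ^ 2) * ε := by positivity
    rw [hQ] at hQε
    linarith
  have hε2 : 1 + c * (T + 1) ^ 2 ≤ 1 / (2 * n ^ 2 * ε) := by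
    have h1 : 0 ≤ 2 * ((T : ℝ) + 1) * n * ε := by positivity
    rw [hQ] at hQε
    rw [le_div_iff₀ (by positivity)]
    linarith
  set a := η * (R / maxRowSum W) with ha
  have ha0 : 0 ≤ a := mul_nonneg hη.le (div_nonneg hR.le (maxRowSum_nonneg hW))
  have haε : ∀ i, ∑ j, a * W i j ≤ ε := sum_gain_mul_le hR.le hη.le hW
  have haε' : ∀ i j, a * W i j ≤ ε := fun i j =>
    (Finset.single_le_sum (fun j _ => mul_nonneg ha0 (hW i j)) (Finset.mem_univ j)).trans (haε i)
  set α : ℕ → ℝ := fun m => totalFlow f W a (G m) (w m) with hα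
  have hα0 : ∀ m, 0 ≤ α m := fun m => totalFlow_nonneg _ _
  set y := undelayedState f W a G (x 0) w with hy
  have hy0 : y 0 = x 0 := by funext i; simp [hy, undelayedState]
  have hysum : ∀ k, ∑ i, y k i = ∑ i, z i := fun k =>
    (sum_undelayedState hWsymm (x 0) w k).trans hx0
  have hxy : ∀ k i, |x k i - y k i| ≤ recentSum α T k := hx.abs_sub_undelayedState_le hf hτ
  have hwy : ∀ k, ∀ θ ∈ Set.Icc (0 : ℝ) 1, ∀ i, |w k θ i - y k i| ≤ 2 * recentSum α T k :=
    fun k θ hθ i => hx.abs_exchanged_sub_undelayedState_le hf hτ k hθ i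
  have hδ : ∀ k, recentSum α T k ≤ 1 / 2 := fun k =>
    (recentSum_le (by positivity) (fun m => totalFlow_le hf ha0 hW haε (G m) (hx.continuous m))
      T k).trans hε1
  have hαδ : ∀ k, α k ≤ recentSum α T k := le_recentSum hα0 T
  have hystep : ∀ k i, |y (k + 1) i - y k i| ≤ α k := fun k i => by
    rw [hy, undelayedState_succ, sub_sub_cancel_left, abs_neg]
    exact abs_sum_meanFlow_le_totalFlow _ _ i
  have hwM : ∀ k, (∀ i, |y k i| ≤ M - 1) → ∀ θ ∈ Set.Icc (0 : ℝ) 1, ∀ i, |w k θ i| ≤ M := by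
    intro k hk θ hθ i
    have h1 := abs_sub_abs_le_abs_sub (w k θ i) (y k i)
    linarith [hwy k θ hθ i, hδ k, hk i]
  set V : ℕ → ℝ := fun k => ∑ i, f i (y k i) with hV
  have hV0 : V 0 ≤ ∑ i, C i := by
    simp only [hV, hy0]
    exact Finset.sum_le_sum fun i _ => (le_abs_self _).trans (hC i _ (abs_le.1 (hxρ i)))
  -- The constant `L` is valid only near the initial sublevel set, so the step estimate is
  -- conditional. The strong induction in `hdec` shows that this set is never left.
  have hstep : ∀ k, V k ≤ V 0 →
      V (k + 1) ≤ V k - 1 / (2 * n ^ 2 * ε) * α k ^ 2 + c * recentSum α T k ^ 2 := by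
    intro k hk
    have hyM := hMy (y k) (hsub _ (hysum k) (hk.trans hV0))
    refine sum_cost_step_le hn hf ha0 hWsymm hW hε0 haε' (G k) (hx.continuous k) hL hlip
      (fun i => (hyM i).trans (by linarith))
      (undelayedState_succ (x 0) w k) (fun i => ?_) (hwM k hyM) (hwy k) (hαδ k)
    have h1 := abs_sub_abs_le_abs_sub (y (k + 1) i) (y k i)
    linarith [hystep k i, hαδ k, hδ k, hyM i]
  have hdec : ∀ K, V K ≤ V 0 - ∑ k ∈ Finset.range K, α k ^ 2 := by
    intro K
    induction K using Nat.strong_induction_on with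
    | _ K ih =>
      have hs : ∀ N, 0 ≤ ∑ k ∈ Finset.range N, α k ^ 2 := fun N =>
        Finset.sum_nonneg fun k _ => sq_nonneg _
      have h1 := le_sub_of_delayed_dissipation hc0 T K fun k hk =>
        hstep k ((ih k hk).trans (sub_le_self _ (hs k)))
      nlinarith [hs K]
  have hVle : ∀ k, V k ≤ V 0 := fun k =>
    (hdec k).trans (sub_le_self _ (Finset.sum_nonneg fun k _ => sq_nonneg _))
  have hyD : ∀ k i, |y k i - z i| ≤ D := fun k => hsub _ (hysum k) ((hVle k).trans hV0)
  have hyM : ∀ k i, |y k i| ≤ M - 1 := fun k => hMy _ (hyD k)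
  have hαlim : Tendsto α atTop (𝓝 0) := by
    have h1 : Summable fun k => α k ^ 2 := by
      refine summable_of_sum_range_le (c := V 0 - ∑ i, f i (z i)) (fun k => sq_nonneg _)
        fun K => ?_
      have h2 := sum_add_sq_le_of_equal_marginal_costs hv hz (hysum K)
      have h3 : 0 ≤ v / 2 * ∑ i, (y K i - z i) ^ 2 :=
        mul_nonneg (by linarith) (Finset.sum_nonneg fun i _ => sq_nonneg _)
      have h4 : ∑ i, f i (y K i) = V K := rfl
      linarith [hdec K]
    have h2 := h1.tendsto_atTop_zero.sqrt
    simpa [Real.sqrt_sq (hα0 _)] using h2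
  have hδlim : Tendsto (recentSum α T) atTop (𝓝 0) := tendsto_recentSum hαlim T
  have hδ0 : ∀ k, 0 ≤ recentSum α T k := recentSum_nonneg hα0 T
  obtain ⟨κ, hκ0, hκ⟩ := exists_pos_le_gain_mul hR hη hW
  -- The first entry controls the drift of marginal costs, the second their difference across an
  -- active link. Once `E * recentSum α T k < 1`, the saturation is inactive.
  set E := max L ((1 + ε * (4 * L)) / κ) with hE
  have hcons := tendsto_sub_of_uniformlyConnected hG
    (g := fun k i => deriv (f i) (y k i)) (e := fun k => E * recentSum α T k)
    (by simpa using hδlim.const_mul E)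
    (by
      have hlt : ∀ᶠ k in atTop, E * recentSum α T k < 1 := by
        have h1 : Tendsto (fun k => E * recentSum α T k) atTop (𝓝 0) := by
          simpa using hδlim.const_mul E
        exact h1.eventually (gt_mem_nhds one_pos)
      filter_upwards [hlt] with k hk i j hij
      have h1 := gain_mul_abs_sat_le hf ha0 hW (hx.continuous k)
        (g := fun i => deriv (f i) (y k i)) (d := L * (2 * recentSum α T k))
        (fun θ hθ i => (hlip i _ _ (hwM k (hyM k) θ hθ i)
          ((hyM k i).trans (by linarith))).trans (by gcongr; exact hwy k θ hθ i)) hij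
      have h2 := (Finset.single_le_sum (fun j _ => meanAbsFlow_nonneg (f := f) (W := W) (a := a)
        (G k) (w k) i j) (Finset.mem_univ j)).trans (sum_meanAbsFlow_le_totalFlow (G k) (w k) i)
      have h3 : |sat (deriv (f i) (y k i) - deriv (f j) (y k j))| ≤ E * recentSum α T k := by
        refine le_trans ?_ (mul_le_mul_of_nonneg_right (le_max_right _ _) (hδ0 k))
        rw [div_mul_eq_mul_div, le_div_iff₀ hκ0, mul_comm]
        calc κ * |sat (deriv (f i) (y k i) - deriv (f j) (y k j))|
            ≤ a * W i j * |sat (deriv (f i) (y k i) - deriv (f j) (y k j))| := by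
              gcongr
              exact hκ i j (hGW k i j hij)
          _ ≤ α k + ε * (2 * (L * (2 * recentSum α T k))) := by
              refine h1.trans (add_le_add h2 (mul_le_mul_of_nonneg_right (haε' i j) ?_))
              have := hδ0 k
              positivity
          _ ≤ (1 + ε * (4 * L)) * recentSum α T k := by linarith [hαδ k]
      rw [sat_eq_self_of_abs_lt (h3.trans_lt hk)] at h3
      exact h3)
    (fun k i => by
      calc _ ≤ L * |y (k + 1) i - y k i| :=
            hlip i _ _ ((hyM _ i).trans (by linarith)) ((hyM _ i).trans (by linarith))
        _ ≤ E * recentSum α T k := by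
            gcongr
            · exact le_max_left _ _
            · exact (hystep k i).trans (hαδ k))
  have hylim := tendsto_of_marginal_consensus hn hv0 hv hz hysum hyD hcons
  refine ⟨tendsto_pi_nhds.2 fun i => ?_, fun i => squeeze_zero
    (fun k => intervalIntegral.integral_nonneg zero_le_one fun _ _ => abs_nonneg _)
    (fun k => integral_abs_delayedRate_le hf hτ hx.continuous k i) hδlim⟩
  have h1 : Tendsto (fun k => x k i - y k i) atTop (𝓝 0) :=
    squeeze_zero_norm (fun k => hxy k i) hδlim
  simpa using h1.add (tendsto_pi_nhds.1 hylim i)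

/-! ### Reduction of the discrete and continuous dynamics to averaged ones -/

section trajectory

variable {n : ℕ} {f : Fin n → ℝ → ℝ} {W : Matrix (Fin n) (Fin n) ℝ} {R η : ℝ} {T : ℕ}
  {G : ℕ → SimpleGraph (Fin n)} {τ : ℕ → Fin n → Fin n → ℕ}

theorem IsDiscreteTrajectory.isAveragedTrajectory {x : ℕ → Fin n → ℝ}
    (hx : IsDiscreteTrajectory f W R η T G τ x) :
    IsAveragedTrajectory f W R η T G τ x fun k _ => x k where
  continuous _ _ := continuous_const
  step k i := by simpa using hx k i
  close k θ _ i := by simp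

theorem abs_sub_le_integral_abs_delayedRate (hf : ∀ i, RegularCost (f i))
    (hτ : ∀ k i j, τ k i j ≤ T) {x : ℝ → Fin n → ℝ} {w : ℕ → ℝ → Fin n → ℝ}
    (hx : ContinuousOn x (Set.Ici 0)) (hw : ∀ k i, Continuous fun θ => w k θ i)
    (hder : ∀ (k : ℕ) (θ : ℝ), θ ∈ Set.Ioo (0 : ℝ) 1 → ∀ i, HasDerivAt (fun t => x t i)
      (delayedRate f W R η T G τ (fun m => w m θ) k i) ((k : ℝ) + θ))
    (k : ℕ) {θ : ℝ} (hθ : θ ∈ Set.Icc (0 : ℝ) 1) (i : Fin n) :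
    ∫ s in (0 : ℝ)..θ, delayedRate f W R η T G τ (fun m => w m s) k i = x (k + θ) i - x k i ∧
    |x (k + θ) i - x k i| ≤
      ∫ s in (0 : ℝ)..1, |delayedRate f W R η T G τ (fun m => w m s) k i| := by
  have hc := continuous_delayedRate (W := W) (R := R) (η := η) (G := G) hf hτ hw k i
  have h1 : ∫ s in (0 : ℝ)..θ, delayedRate f W R η T G τ (fun m => w m s) k i =
      x (k + θ) i - x k i := by
    have h2 := intervalIntegral.integral_eq_sub_of_hasDerivAt_of_le
      (f := fun s : ℝ => x (k + s) i) hθ.1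
      (((continuous_apply i).comp_continuousOn hx).comp (by fun_prop) fun s hs =>
        Set.mem_Ici.2 (add_nonneg k.cast_nonneg hs.1))
      (fun s hs => (hder k s ⟨hs.1, hs.2.trans_le hθ.2⟩ i).comp_const_add (k : ℝ) s)
      (hc.intervalIntegrable 0 θ)
    simpa using h2
  refine ⟨h1, ?_⟩
  rw [← h1]
  refine (intervalIntegral.abs_integral_le_integral_abs hθ.1).trans ?_
  exact intervalIntegral.integral_mono_interval le_rfl hθ.1 hθ.2
    (Eventually.of_forall fun s => abs_nonneg _) (hc.abs.intervalIntegrable 0 1)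

theorem isAveragedTrajectory_of_hasDerivAt (hf : ∀ i, RegularCost (f i))
    (hτ : ∀ k i j, τ k i j ≤ T) {x : ℝ → Fin n → ℝ} {w : ℕ → ℝ → Fin n → ℝ}
    (hx : ContinuousOn x (Set.Ici 0)) (hw : ∀ k i, Continuous fun θ => w k θ i)
    (hder : ∀ (k : ℕ) (θ : ℝ), θ ∈ Set.Ioo (0 : ℝ) 1 → ∀ i, HasDerivAt (fun t => x t i)
      (delayedRate f W R η T G τ (fun m => w m θ) k i) ((k : ℝ) + θ))
    (hwx : ∀ (k : ℕ), ∀ θ ∈ Set.Icc (0 : ℝ) 1, w k θ = x k ∨ w k θ = x (k + θ)) :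
    IsAveragedTrajectory f W R η T G τ (fun k => x k) w where
  continuous := hw
  step k i := by
    rw [(abs_sub_le_integral_abs_delayedRate hf hτ hx hw hder k
      (Set.right_mem_Icc.2 zero_le_one) i).1]
    push_cast
    ring
  close k θ hθ i := by
    rcases hwx k θ hθ with h | h <;> rw [h]
    · rw [sub_self, abs_zero]
      exact intervalIntegral.integral_nonneg zero_le_one fun _ _ => abs_nonneg _
    · exact (abs_sub_le_integral_abs_delayedRate hf hτ hx hw hder k hθ i).2

/-- Continuous-time trajectories follow averaged ones, with states exchanged at the sampling times
or continuously. -/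
theorem exists_exchanged_states {x : ℝ → Fin n → ℝ}
    (hx : IsSampledTrajectory f W R η T G τ x ∨ IsContinuousTrajectory f W R η T G τ x) :
    ContinuousOn x (Set.Ici 0) ∧ ∃ w : ℕ → ℝ → Fin n → ℝ,
      (∀ k i, Continuous fun θ => w k θ i) ∧
      (∀ (k : ℕ) (θ : ℝ), θ ∈ Set.Ioo (0 : ℝ) 1 → ∀ i, HasDerivAt (fun t => x t i)
        (delayedRate f W R η T G τ (fun m => w m θ) k i) ((k : ℝ) + θ)) ∧
      ∀ (k : ℕ), ∀ θ ∈ Set.Icc (0 : ℝ) 1, w k θ = x k ∨ w k θ = x (k + θ) := by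
  rcases hx with ⟨hc, h⟩ | ⟨hc, h⟩
  · exact ⟨hc, fun k _ => x k, fun _ _ => continuous_const, h, fun k θ _ => Or.inl rfl⟩
  -- Clamping at `0` makes the exchanged states continuous on the whole line, although `x` is
  -- continuous only on `[0, ∞)`.
  · refine ⟨hc, fun k θ => x (max 0 (k + θ)), fun k i => ?_, fun k θ hθ i => ?_,
      fun k θ hθ => Or.inr ?_⟩
    · exact (continuous_apply i).comp (hc.comp_continuous (by fun_prop) fun θ =>
        Set.mem_Ici.2 (le_max_left _ _))
    · have h1 : ∀ m : ℕ, max 0 ((m : ℝ) + θ) = m + θ := fun m =>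
        max_eq_right (add_nonneg m.cast_nonneg hθ.1.le)
      simp only [h1]
      exact h k θ hθ i
    · simp only [max_eq_right (add_nonneg k.cast_nonneg hθ.1)]

end trajectory

/-- The oscillation within each time unit vanishes, so convergence at integer times suffices. -/
theorem tendsto_atTop_of_tendsto_nat {n : ℕ} {x : ℝ → Fin n → ℝ} {z : Fin n → ℝ}
    (hx : Tendsto (fun k : ℕ => x k) atTop (𝓝 z)) {b : ℕ → Fin n → ℝ}
    (hb : ∀ i, Tendsto (fun k => b k i) atTop (𝓝 0))
    (h : ∀ (k : ℕ), ∀ θ ∈ Set.Icc (0 : ℝ) 1, ∀ i, |x (k + θ) i - x k i| ≤ b k i) :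
    Tendsto x atTop (𝓝 z) := by
  refine tendsto_pi_nhds.2 fun i => ?_
  have hfl : Tendsto (fun t : ℝ => ⌊t⌋₊) atTop atTop := tendsto_nat_floor_atTop
  have h1 : Tendsto (fun t : ℝ => x t i - x ⌊t⌋₊ i) atTop (𝓝 0) := by
    refine squeeze_zero_norm' ?_ ((hb i).comp hfl)
    filter_upwards [eventually_ge_atTop 0] with t ht
    have h2 := h ⌊t⌋₊ (t - ⌊t⌋₊)
      ⟨sub_nonneg.2 (Nat.floor_le ht), by linarith [Nat.lt_floor_add_one t]⟩ i
    rwa [add_sub_cancel] at h2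
  simpa using h1.add ((tendsto_pi_nhds.1 hx i).comp hfl)

end AGC

/-! ### The main theorem -/

theorem mainTheorem4 (n : ℕ) (hn : 0 < n)
    (fbar : Fin n → ℝ → ℝ) (hfbar : ∀ i, AGC.RegularCost (fbar i))
    (mlo mhi : Fin n → ℝ) (c : ℝ) (hc : 0 ≤ c) (σ : ℕ) (hσ : 2 ≤ σ)
    (f : Fin n → ℝ → ℝ) (hf : ∀ i, f i = AGC.objective (fbar i) (mlo i) (mhi i) c σ)
    (Pmis R : ℝ) (hR : 0 < R)
    (W : Matrix (Fin n) (Fin n) ℝ) (hWsymm : W.IsSymm) (hWnonneg : ∀ i j, 0 ≤ W i j)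
    (τbar : ℕ) :
    ∃ xstar : Fin n → ℝ,
      AGC.IsOptimalOn f Pmis Set.univ xstar ∧
      (∀ z, AGC.IsOptimalOn f Pmis Set.univ z → z = xstar) ∧
      (xstar ∈ AGC.box mlo mhi → AGC.IsOptimalOn fbar Pmis (AGC.box mlo mhi) xstar) ∧
      ∀ ρ : ℝ, ∃ η₀ : ℝ, 0 < η₀ ∧ ∀ η : ℝ, 0 < η → η ≤ η₀ →
        ∀ (B : ℕ) (G : ℕ → SimpleGraph (Fin n)) (τ : ℕ → Fin n → Fin n → ℕ),
          (∀ k i j, (G k).Adj i j → 0 < W i j) →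
          AGC.UniformlyConnected G B →
          (∀ k i j, τ k i j ≤ τbar) →
          (∀ x : ℕ → Fin n → ℝ, ∑ i, x 0 i = Pmis → (∀ i, |x 0 i| ≤ ρ) →
            AGC.IsDiscreteTrajectory f W R η τbar G τ x →
            Tendsto x atTop (𝓝 xstar)) ∧
          (∀ x : ℝ → Fin n → ℝ, ∑ i, x 0 i = Pmis → (∀ i, |x 0 i| ≤ ρ) →
            (AGC.IsSampledTrajectory f W R η τbar G τ x ∨
              AGC.IsContinuousTrajectory f W R η τbar G τ x) →
            Tendsto x atTop (𝓝 xstar)) := by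

  have hreg : ∀ i, AGC.RegularCost (f i) := fun i =>
    hf i ▸ AGC.regularCost_objective (hfbar i) (mlo i) (mhi i) hc hσ
  obtain ⟨z, l, hz, hzP⟩ := AGC.exists_equal_marginal_costs hn hreg Pmis
  obtain ⟨v, hv0, hv⟩ := AGC.exists_tangent_le_uniform hreg
  obtain ⟨hopt, huniq⟩ := AGC.isOptimalOn_of_equal_marginal_costs hv0 hv hz hzP
  refine ⟨z, hopt, huniq, AGC.isOptimalOn_box hσ hf hopt, fun ρ => ?_⟩
  obtain ⟨η₀, hη₀, h⟩ := AGC.exists_step_tendsto_averaged hn hreg hR hWsymm hWnonneg τbar hz ρ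
  refine ⟨η₀, hη₀, fun η hη hηle B G τ hGW hG hτ =>
    ⟨fun x hx0 hxρ hx => ?_, fun x hx0 hxρ hx => ?_⟩⟩
  · exact (h η hη hηle B G τ hGW hG hτ x _ hx.isAveragedTrajectory (hx0.trans hzP.symm) hxρ).1
  · obtain ⟨hxc, w, hw, hder, hwx⟩ := AGC.exists_exchanged_states hx
    have havg := AGC.isAveragedTrajectory_of_hasDerivAt hreg hτ hxc hw hder hwx
    obtain ⟨h1, h2⟩ := h η hη hηle B G τ hGW hG hτ _ w havg
      (by simpa using hx0.trans hzP.symm) (by simpa using hxρ)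
    exact AGC.tendsto_atTop_of_tendsto_nat h1 h2 fun k θ hθ i =>
      (AGC.abs_sub_le_integral_abs_delayedRate hreg hτ hxc hw hder k hθ i).2
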